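/- Setting. Let $A\neq 0$ be a finite-dimensional real alternative algebra with unit $1$ and a real-linear anti-involution $x\mapsto x^c$; put $t(x)=x+x^c$, $n(x)=xx^c$, and identify $\mathbb R$ with $\mathbb R 1$. Let $Q_A=\mathbb R\cup\{x\in A: t(x),n(x)\in\mathbb R,\ 4n(x)>t(x)^2\}$ be the quadratic cone and $\mathbb S_A=\{J\in Q_A: J^2=-1\}$. For $J\in\mathbb S_A$ let $\mathbb C_J=\mathbb R+\mathbb RJ$ and $\Phi_J(\alpha+i\beta)=\alpha+\beta J$. Nonzero $x\in Q_A$ have the inverse $x^{-1}=n(x)^{-1}x^c$. Let $\|\cdot\|$ be a norm on the real vector space $A$ with $\|x\|=\sqrt{n(x)}$ for $x\in Q_A$. Let $D\subseteq\mathbb C$ be open and invariant under complex conjugation, and $O_D=\{\Phi_J(z): z\in D,\ J\in\mathbb S_A\}$. A stem function on $D$ is a map $F=F_1+iF_2:D\to A\otimes_{\mathbb R}\mathbb C$ ($F_1,F_2$ with values in $A$) with $F(\bar z)=\overline{F(z)}$; it induces the slice function $\mathcal I(F)(\alpha+\beta J)=F_1(\alpha+i\beta)+J\,F_2(\alpha+i\beta)$.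 The slice product is $\mathcal I(F)\cdot\mathcal I(G)=\mathcal I(FG)$. A function $f:O_D\to A$ is slice regular if $f=\mathcal I(F)$ for a holomorphic stem function $F$ (that is, $F_1,F_2$ are $C^1$ and $\partial F/\partial\bar z=0$). For $y\in Q_A$ let $\Delta_y(x)=x^2-x\,t(y)+n(y)$, $S_{y,2m}(x)=\Delta_y(x)^m$, $S_{y,2m+1}(x)=\Delta_y(x)^m(x-y)$; these are the slice functions induced by $\Delta_y(z)^m$ and $\Delta_y(z)^m(z-y)$. For $s\in A$, $S_{y,n}s$ denotes the slice product of $S_{y,n}$ with the constant $s$, i.e. the slice function induced by the stem function of $S_{y,n}$ multiplied on the right by $s$; if $A$ is associative, this is the pointwise product $S_{y,n}(x)s$. Let $\tau_A(x,y)=\sqrt{\|\Delta_y(x)\|}$ and, for $r>0$, $\Omega_A(y,r)=\{x\in Q_A:\tau_A(x,y)<r\}$. For $w,z\in\mathbb C$ let $\Delta_w(z)=(z-w)(z-\bar w)$ and $\Omega(w,r)=\{z\in\mathbb C: |\Delta_w(z)|<r^2\}$. Theorem. There are constants $C,C'>0$, depending only on $A$ with its anti-involution and on $\|\cdot\|$,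 such that the following holds. Let $f:O_D\to A$ be slice regular, $y\in O_D$, $J\in\mathbb S_A$ and $w\in\mathbb C$ with $y=\Phi_J(w)$, and let $r>0$ be such that the closure of $\Omega_A(y,r)$ in $Q_A$ is contained in $O_D$. Let $\Omega_J=\Omega_A(y,r)\cap\mathbb C_J=\Phi_J(\Omega(w,r))$, let $\partial\Omega_J$ be its boundary in $\mathbb C_J\cong\mathbb C$ (via $\Phi_J$), positively oriented, and let $S_f=\sup_{\partial\Omega_J}\|f\|$. (i) There is a unique sequence $(s_n)_{n\ge0}$ in $A$ such that $f(x)=\sum_{n=0}^\infty (S_{y,n}s_n)(x)$ for every $x\in\Omega_A(y,r)$. (ii) For every $n\ge 0$, $$s_n=(2\pi J)^{-1}\int_{\partial\Omega_J}S_{y,n+1}(\zeta)^{-1}\,d\zeta\,f(\zeta),\qquad \|s_n\|\le C\,S_f\,r^{-n}.$$ (iii) For every $n\ge 0$, the function $$z\longmapsto\int_{\partial\Omega_J}\Delta_\zeta(z)^{-1}(\zeta^c-z)J^{-1}S_{y,n+1}(\zeta)^{-1}\,d\zeta\,f(\zeta)\in A\otimes_{\mathbb R}\mathbb C$$ is a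 holomorphic stem function on $\Omega(w,r)$, where $\Delta_\zeta(z)=z^2-z\,t(\zeta)+n(\zeta)$. If $R_{y,n}(f):\Omega_A(y,r)\to A$ denotes the slice regular function that it induces, then for every $x\in\Omega_A(y,r)$ $$f(x)-\sum_{k=0}^n (S_{y,k}s_k)(x)=(2\pi)^{-1}\bigl(S_{y,n+1}\cdot R_{y,n}(f)\bigr)(x).$$ If $A$ is associative, then moreover, for every $x\in\Omega_A(y,r)$, $$R_{y,n}(f)(x)=\int_{\partial\Omega_J}\Delta_\zeta(x)^{-1}(\zeta^c-x)J^{-1}S_{y,n+1}(\zeta)^{-1}\,d\zeta\,f(\zeta).$$ (iii$'$) For every $n\ge0$ and every $x\in\Omega_A(y,r)$, $$\Bigl\|f(x)-\sum_{k=0}^n (S_{y,k}s_k)(x)\Bigr\|\le C'\,S_f\,\frac{\tau_A(x,y)^n}{r^n}\cdot\frac{(3r+2|\mathrm{Im}\,w|)(r+2|\mathrm{Im}\,w|)^2}{r\,(r-\tau_A(x,y))^2}.$$ -/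

import Mathlib

open Set Filter Topology
open scoped ComplexConjugate

/-! ### Real alternative *-algebras -/

/-- A (not necessarily associative) unital ring with a norm whose distance is the metric.
No compatibility between the norm and the multiplication is required. -/
class NormedNonAssocRing (A : Type*) extends Norm A, NonAssocRing A, MetricSpace A where
  dist_eq : ∀ x y : A, dist x y = norm (-x + y)

instance (priority := 100) NormedNonAssocRing.toNormedAddCommGroup {A : Type*}
    [β : NormedNonAssocRing A] : NormedAddCommGroup A :=
  { β with }

set_option linter.unusedSectionVars false

noncomputable section

namespace SliceReg

/-- The alternative laws. -/
def IsAlternative (A : Type*) [Mul A] : Prop :=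
  (∀ a b : A, (a * a) * b = a * (a * b)) ∧ (∀ a b : A, (b * a) * a = b * (a * a))

/-- The `n`-th power (bracketed from the left). -/
def pow' {B : Type*} [One B] [Mul B] (x : B) (n : ℕ) : B := npowRec n x

section Algebra

variable {A : Type*} [NormedNonAssocRing A] [NormedSpace ℝ A] [StarRing A]

/-- The trace `t(x) = x + xᶜ`; the anti-involution is written `star`. -/
def tr (x : A) : A := x + star x

/-- The squared norm `n(x) = x xᶜ`. -/
def sqn (x : A) : A := x * star x

variable (A) in
/-- The quadratic cone `Q_A`; real numbers are identified with the real multiples of `1`. -/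
def quadraticCone : Set A :=
  {x | ∃ a : ℝ, x = a • (1 : A)} ∪
    {x | ∃ t n : ℝ, tr x = t • (1 : A) ∧ sqn x = n • (1 : A) ∧ t ^ 2 < 4 * n}

variable (A) in
/-- The square roots of `-1` in the quadratic cone. -/
def sphere : Set A := {J | J ∈ quadraticCone A ∧ J * J = -1}

variable (A) in
/-- `‖x‖ = √n(x)` on the quadratic cone. -/
def NormOnCone : Prop := ∀ x ∈ quadraticCone A, sqn x = (‖x‖ ^ 2) • (1 : A)

/-- `Φ_J(α + iβ) = α + βJ`. -/
def Phi (J : A) (z : ℂ) : A := z.re • (1 : A) + z.im • J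

/-- The inverse `n(x)⁻¹ xᶜ` of a nonzero element of the quadratic cone
(where `n(x) = ‖x‖ ^ 2`). -/
def coneInv (x : A) : A := (‖x‖ ^ 2)⁻¹ • star x

/-- The characteristic polynomial `Δ_y(x) = x² - x t(y) + n(y)`. -/
def charPoly (y x : A) : A := x * x - x * tr y + sqn y

/-- The Cassini pseudo-metric `τ_A(x, y) = √‖Δ_y(x)‖` (used for `x, y` in the quadratic cone). -/
def cassini (x y : A) : ℝ := Real.sqrt ‖charPoly y x‖

/-- The open ball `Ω_A(y, r)` of the Cassini pseudo-metric in the quadratic cone. -/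
def cassiniBall (y : A) (r : ℝ) : Set A := {x | x ∈ quadraticCone A ∧ cassini x y < r}

/-- The boundary, in the plane `ℂ_J`, of `Ω_A(y, r) ∩ ℂ_J`. -/
def cassiniBoundary (J y : A) (r : ℝ) : Set A :=
  Phi J '' frontier {z : ℂ | Phi J z ∈ cassiniBall y r}

/-- The circular set `O_D`. -/
def circularSet (D : Set ℂ) : Set A :=
  {x | x ∈ quadraticCone A ∧ ∃ z ∈ D, ∃ J ∈ sphere A, x = Phi J z}

theorem mul_coneInv (hN : NormOnCone A) [SMulCommClass ℝ A A] {x : A}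
    (hx : x ∈ quadraticCone A) (h0 : x ≠ 0) : x * coneInv x = 1 := by
  have h1 : (‖x‖ ^ 2) ≠ 0 := by positivity
  have h2 : x * star x = (‖x‖ ^ 2) • (1 : A) := hN x hx
  rw [coneInv, mul_smul_comm, h2, smul_smul, inv_mul_cancel₀ h1, one_smul]

end Algebra

/-! ### The complexification and slice functions -/

/-- The complexification `A ⊗ ℂ`, whose elements are written `re + i im` with `re, im ∈ A`. -/
@[ext] structure Cx (A : Type*) where
  re : A
  im : A

namespace Cx

variable {A : Type*} [NormedNonAssocRing A]

instance : One (Cx A) := ⟨⟨1, 0⟩⟩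
instance : Add (Cx A) := ⟨fun a b => ⟨a.re + b.re, a.im + b.im⟩⟩
instance : Sub (Cx A) := ⟨fun a b => ⟨a.re - b.re, a.im - b.im⟩⟩
instance : Mul (Cx A) :=
  ⟨fun a b => ⟨a.re * b.re - a.im * b.im, a.re * b.im + a.im * b.re⟩⟩

/-- Complex conjugation `x + iy ↦ x - iy`. -/
def bar (a : Cx A) : Cx A := ⟨a.re, -a.im⟩

/-- The inclusion of `A`. -/
def ofA (a : A) : Cx A := ⟨a, 0⟩

/-- The inclusion of `ℂ`. -/
def ofC [NormedSpace ℝ A] (z : ℂ) : Cx A := ⟨z.re • (1 : A), z.im • (1 : A)⟩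

end Cx

section Slice

variable {A : Type*} [NormedNonAssocRing A] [NormedSpace ℝ A] [StarRing A]

/-- Stem functions on `D`: `F(z̄)` is the conjugate of `F(z)`. -/
def IsStem (D : Set ℂ) (F : ℂ → Cx A) : Prop := ∀ z ∈ D, F (conj z) = (F z).bar

/-- Holomorphy of `F = F₁ + i F₂` on an open set `D`: `F₁, F₂` are of class `C¹` and
`∂F/∂α + i ∂F/∂β = 0`. -/
def IsHolo (D : Set ℂ) (F : ℂ → Cx A) : Prop :=
  ContDiffOn ℝ 1 (fun z => (F z).re) D ∧ ContDiffOn ℝ 1 (fun z => (F z).im) D ∧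
    ∀ z ∈ D,
      fderiv ℝ (fun z => (F z).re) z 1 = fderiv ℝ (fun z => (F z).im) z Complex.I ∧
      fderiv ℝ (fun z => (F z).im) z 1 = -fderiv ℝ (fun z => (F z).re) z Complex.I

open Classical in
/-- The slice function `I(F)` induced by `F = F₁ + i F₂`: `I(F)(α + βJ) = F₁(z) + J F₂(z)` with
`z = α + iβ`. If `F` is a stem function, the value does not depend on the representation of the
point, see `slice_apply`. -/
def slice (F : ℂ → Cx A) (x : A) : A :=
  if h : ∃ p : ℂ × A, p.2 ∈ sphere A ∧ x = Phi p.2 p.1 then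
    (F h.choose.1).re + h.choose.2 * (F h.choose.1).im
  else 0

/-- The slice product `I(F) · I(G) = I(FG)` of the slice functions induced by `F` and `G`. -/
def sliceMul (F G : ℂ → Cx A) : A → A := slice fun z => F z * G z

/-- Slice regular functions on the circular set `O_D`; only the values of `f` on `O_D` matter. -/
def IsSliceRegular (D : Set ℂ) (f : A → A) : Prop :=
  ∃ F : ℂ → Cx A, IsStem D F ∧ IsHolo D F ∧ ∀ x ∈ circularSet D, f x = slice F x

theorem star_sphere [StarModule ℝ A] [Nontrivial A] [SMulCommClass ℝ A A] {J : A}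
    (hJ : J ∈ sphere A) : star J = -J := by
  obtain ⟨hQ, hJ2⟩ := hJ
  have key : ¬ ∃ a : ℝ, J = a • (1 : A) := by
    rintro ⟨a, rfl⟩
    rw [mul_smul_comm, mul_one, smul_smul] at hJ2
    have h : (a * a + 1) • (1 : A) = 0 := by rw [add_smul, one_smul, hJ2]; simp
    rcases smul_eq_zero.1 h with h | h
    · nlinarith [mul_self_nonneg a]
    · exact one_ne_zero h
  rcases hQ with hQ | ⟨t, n, ht, hn, -⟩
  · exact absurd hQ key
  have hs : star J = t • (1 : A) - J := by
    rw [← ht]; simp [tr]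
  have h2 : t • J = (n - 1) • (1 : A) := by
    have h3 := hn
    rw [sqn, hs, mul_sub, mul_smul_comm, mul_one, hJ2] at h3
    rw [sub_smul, ← h3]; simp
  by_cases h0 : t = 0
  · rw [hs, h0]; simp
  · exfalso
    refine key ⟨t⁻¹ * (n - 1), ?_⟩
    rw [mul_smul, ← h2, smul_smul, inv_mul_cancel₀ h0, one_smul]

theorem slice_apply [StarModule ℝ A] [Nontrivial A] [SMulCommClass ℝ A A] [IsScalarTower ℝ A A]
    {D : Set ℂ} {F : ℂ → Cx A} (hF : IsStem D F) {z : ℂ} (hz : z ∈ D) {J : A}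
    (hJ : J ∈ sphere A) : slice F (Phi J z) = (F z).re + J * (F z).im := by
  have h : ∃ p : ℂ × A, p.2 ∈ sphere A ∧ Phi J z = Phi p.2 p.1 := ⟨(z, J), hJ, rfl⟩
  rw [slice, dif_pos h]
  obtain ⟨hI, he⟩ := h.choose_spec
  generalize h.choose = p at hI he
  obtain ⟨u, I⟩ := p
  simp only at hI he ⊢
  have hs : Phi J (conj z) = Phi I (conj u) := by
    have := congrArg star he
    simpa [Phi, star_sphere hJ, star_sphere hI] using this
  have hre : z.re = u.re := by
    have h1 : ((2 * (z.re - u.re)) : ℝ) • (1 : A) = 0 := by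
      have h2 := congrArg₂ (· + ·) he hs
      simp only [Phi, Complex.conj_re, Complex.conj_im, neg_smul] at h2
      have h3 : (2 * z.re) • (1 : A) = (2 * u.re) • (1 : A) := by
        rw [two_mul, two_mul, add_smul, add_smul]
        convert h2 using 1 <;> abel
      rw [mul_sub, sub_smul, h3, sub_self]
    rcases smul_eq_zero.1 h1 with h | h
    · linarith
    · exact absurd h one_ne_zero
  have him : z.im • J = u.im • I := by
    simpa [Phi, hre] using he
  have hsq : z.im * z.im = u.im * u.im := by
    have h1 : (z.im • J) * (z.im • J) = (u.im • I) * (u.im • I) := by rw [him]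
    simp only [smul_mul_smul_comm, hJ.2, hI.2] at h1
    have h2 : (z.im * z.im - u.im * u.im) • (-1 : A) = 0 := by rw [sub_smul, h1, sub_self]
    rcases smul_eq_zero.1 h2 with h | h
    · linarith
    · exact absurd (neg_eq_zero.1 h) one_ne_zero
  by_cases h0 : z.im = 0
  · have h0' : u.im = 0 := by
      rw [h0] at hsq; simpa using hsq.symm
    have huz : u = z := Complex.ext hre.symm (by rw [h0, h0'])
    subst huz
    have hc : conj u = u := Complex.ext (by simp) (by simp [h0])
    have hb := congrArg Cx.im (hF u hz)
    rw [hc] at hb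
    have hb' : (F u).im = 0 := by
      have h2 : (2 : ℝ) • (F u).im = 0 := by
        rw [two_smul]
        nth_rewrite 1 [hb]
        simp [Cx.bar]
      exact (smul_eq_zero.1 h2).resolve_left two_ne_zero
    rw [hb']; simp
  · rcases mul_self_eq_mul_self_iff.1 hsq with h | h
    · have huz : u = z := Complex.ext hre.symm h.symm
      subst huz
      rw [smul_right_injective A h0 him]
    · have huz : u = conj z := Complex.ext (by simp [hre]) (by simp [h])
      have hJI : I = -J := by
        have hu : u.im ≠ 0 := by intro h'; apply h0; rw [h, h']; simp
        apply smul_right_injective A hu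
        simp only [← him, h, neg_smul, smul_neg]
      rw [huz, hF z hz, hJI]
      simp [Cx.bar]

end Slice

/-! ### Spherical polynomials -/

section Spherical

variable {A : Type*} [NormedNonAssocRing A] [NormedSpace ℝ A] [StarRing A]

/-- The function `z ↦ Δ_y(z) = z² - z t(y) + n(y)` with values in the complexification. -/
def charStem (y : A) (z : ℂ) : Cx A :=
  Cx.ofC z * Cx.ofC z - Cx.ofC z * Cx.ofA (tr y) + Cx.ofA (sqn y)

/-- The stem function of the spherical polynomial `S_{y,n}`:
`Δ_y(z)^m` for `n = 2m` and `Δ_y(z)^m (z - y)` for `n = 2m + 1`. -/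
def sphStem (y : A) (n : ℕ) (z : ℂ) : Cx A :=
  if Even n then pow' (charStem y z) (n / 2)
  else pow' (charStem y z) (n / 2) * (Cx.ofC z - Cx.ofA y)

/-- The spherical polynomial `S_{y,n}`:
`Δ_y(x)^m` for `n = 2m` and `Δ_y(x)^m (x - y)` for `n = 2m + 1`. -/
def sphPoly (y : A) (n : ℕ) (x : A) : A :=
  if Even n then pow' (charPoly y x) (n / 2) else pow' (charPoly y x) (n / 2) * (x - y)

section

variable [StarModule ℝ A] [Nontrivial A] [SMulCommClass ℝ A A] [IsScalarTower ℝ A A]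

/-- `Δ_w(z) = (z - w)(z - w̄)` for complex numbers. -/
def deltaC (w z : ℂ) : ℂ := (z - w) * (z - conj w)

theorem tr_Phi {J : A} (hJ : J ∈ sphere A) (w : ℂ) : tr (Phi J w) = (2 * w.re) • (1 : A) := by
  simp only [tr, Phi, star_add, star_smul, star_one, star_sphere hJ, star_trivial, smul_neg]
  rw [two_mul, add_smul]; abel

theorem sqn_Phi {J : A} (hJ : J ∈ sphere A) (w : ℂ) :
    sqn (Phi J w) = (w.re ^ 2 + w.im ^ 2) • (1 : A) := by
  simp only [sqn, Phi, star_add, star_smul, star_one, star_sphere hJ, star_trivial, smul_neg]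
  simp only [add_mul, mul_add, mul_neg, smul_mul_smul_comm, hJ.2, mul_one, one_mul, smul_neg]
  rw [add_smul, mul_comm w.im w.re, pow_two, pow_two]; abel

theorem Phi_mul {J : A} (hJ : J ∈ sphere A) (u v : ℂ) : Phi J (u * v) = Phi J u * Phi J v := by
  simp only [Phi, add_mul, mul_add, smul_mul_smul_comm, hJ.2, mul_one, one_mul, smul_neg,
    Complex.mul_re, Complex.mul_im, sub_smul, add_smul]
  abel

theorem Phi_pow {J : A} (hJ : J ∈ sphere A) (u : ℂ) (m : ℕ) :
    pow' (Phi J u) m = Phi J (u ^ m) := by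
  induction m with
  | zero => simp [pow', npowRec, Phi]
  | succ m ih =>
    rw [pow_succ, Phi_mul hJ, ← ih]; rfl

theorem ofC_pow (u : ℂ) (m : ℕ) : pow' (Cx.ofC u : Cx A) m = Cx.ofC (u ^ m) := by
  induction m with
  | zero => ext <;> simp [pow', npowRec, Cx.ofC] <;> rfl
  | succ m ih =>
    have : (Cx.ofC (u ^ (m + 1)) : Cx A) = Cx.ofC (u ^ m) * Cx.ofC u := by
      rw [pow_succ]
      ext
      · change _ = (u ^ m).re • (1 : A) * u.re • (1 : A) - (u ^ m).im • (1 : A) * u.im • (1 : A)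
        simp only [Cx.ofC, Complex.mul_re, smul_mul_smul_comm, mul_one, sub_smul]
      · change _ = (u ^ m).re • (1 : A) * u.im • (1 : A) + (u ^ m).im • (1 : A) * u.re • (1 : A)
        simp only [Cx.ofC, Complex.mul_im, smul_mul_smul_comm, mul_one, add_smul]
    rw [this, ← ih]; rfl

theorem charPoly_Phi {I J : A} (hI : I ∈ sphere A) (hJ : J ∈ sphere A) (w z : ℂ) :
    charPoly (Phi I w) (Phi J z) = Phi J (deltaC w z) := by
  rw [charPoly, tr_Phi hI, sqn_Phi hI, ← Phi_mul hJ, mul_smul_comm, mul_one]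
  simp only [Phi, deltaC, smul_add, smul_smul]
  have h1 : ((z - w) * (z - conj w)).re
      = (z * z).re - 2 * w.re * z.re + (w.re ^ 2 + w.im ^ 2) := by
    simp; ring
  have h2 : ((z - w) * (z - conj w)).im = (z * z).im - 2 * w.re * z.im := by
    simp; ring
  rw [h1, h2]
  simp only [add_smul, sub_smul]
  abel

theorem charStem_Phi {I : A} (hI : I ∈ sphere A) (w z : ℂ) :
    charStem (Phi I w) z = Cx.ofC (deltaC w z) := by
  rw [charStem, tr_Phi hI, sqn_Phi hI]
  ext
  · change z.re • (1 : A) * z.re • (1 : A) - z.im • (1 : A) * z.im • (1 : A) -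
      (z.re • (1 : A) * (2 * w.re) • (1 : A) - z.im • (1 : A) * 0) +
      (w.re ^ 2 + w.im ^ 2) • (1 : A) = ((z - w) * (z - conj w)).re • (1 : A)
    simp only [smul_mul_smul_comm, mul_one, mul_zero, sub_zero, ← sub_smul, ← add_smul]
    congr 1; simp; ring
  · change z.re • (1 : A) * z.im • (1 : A) + z.im • (1 : A) * z.re • (1 : A) -
      (z.re • (1 : A) * 0 + z.im • (1 : A) * (2 * w.re) • (1 : A)) + 0 =
      ((z - w) * (z - conj w)).im • (1 : A)
    simp only [smul_mul_smul_comm, mul_one, mul_zero, zero_add, add_zero, ← sub_smul, ← add_smul]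
    congr 1; simp; ring

/-- The spherical polynomial `S_{y,n}` is the slice function induced by `sphStem y n`. -/
theorem sphPoly_Phi {I J : A} (hI : I ∈ sphere A) (hJ : J ∈ sphere A) (w z : ℂ) (n : ℕ) :
    sphPoly (Phi I w) n (Phi J z) =
      (sphStem (Phi I w) n z).re + J * (sphStem (Phi I w) n z).im := by
  rw [sphPoly, sphStem, charPoly_Phi hI hJ, charStem_Phi hI, Phi_pow hJ, ofC_pow]
  generalize deltaC w z ^ (n / 2) = p
  generalize Phi I w = y
  split_ifs with h
  · simp [Cx.ofC, Phi, mul_smul_comm]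
  · change _ = (p.re • (1 : A) * (z.re • (1 : A) - y) - p.im • (1 : A) * (z.im • (1 : A) - 0)) +
      J * (p.re • (1 : A) * (z.im • (1 : A) - 0) + p.im • (1 : A) * (z.re • (1 : A) - y))
    rw [mul_sub, ← Phi_mul hJ]
    simp only [Phi, Complex.mul_re, Complex.mul_im, sub_zero, mul_add, mul_sub, add_mul,
      smul_mul_assoc, mul_smul_comm, one_mul, mul_one, sub_smul, add_smul, smul_smul]
    rw [mul_comm z.im p.re, mul_comm z.re p.im, mul_comm z.re p.re, mul_comm z.im p.im]
    abel

end

/-- The value at `x` of the spherical monomial `S_{y,n} s`, the slice product of `S_{y,n}` and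
the constant function `s`. -/
def sphTerm (y : A) (n : ℕ) (s : A) : A → A := sliceMul (sphStem y n) (fun _ => Cx.ofA s)

/-- `f = ∑ S_{y,n} s_n` pointwise on `Ω_A(y, r)`. -/
def IsSphericalExpansion (f : A → A) (y : A) (r : ℝ) (s : ℕ → A) : Prop :=
  ∀ x ∈ cassiniBall y r,
    Tendsto (fun N => ∑ k ∈ Finset.range N, sphTerm y k (s k) x) atTop (𝓝 (f x))

end Spherical

/-! ### Integration along the boundary of a Cassini ball -/

/-- The complex Cassini ball `{z | √|Δ_w(z)| < r}`. -/
def cassiniBallC (w : ℂ) (r : ℝ) : Set ℂ := {z | Real.sqrt ‖deltaC w z‖ < r}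

/-- For `w = ξ + iη` and `ε = ±1`, the arc `θ ↦ ξ ± i √(η² - r² e^{iθ})`, `0 ≤ θ ≤ 2π`. The
boundary of the Cassini ball is the set of solutions of `Δ_w(ζ) = r² e^{iθ}`, `0 ≤ θ ≤ 2π`, and
`Δ_w(ζ) = (ζ - ξ)² + η²`, so that the two arcs together run once, with positive orientation,
through this boundary. (The argument of the principal square root avoids the negative real axis
for `0 < θ < 2π`. If `r < |η|`, each arc is one of the two ovals; if `r = |η|`, each
is a loop of the lemniscate; if `r > |η|`, together they form one oval.) -/
def cassiniArc (w : ℂ) (r ε θ : ℝ) : ℂ :=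
  w.re + ε * Complex.I *
    (((w.im : ℂ) ^ 2 - (r : ℂ) ^ 2 * Complex.exp (θ * Complex.I)) ^ (1 / 2 : ℂ))

theorem deltaC_cassiniArc (w : ℂ) (r ε θ : ℝ) (hε : ε ^ 2 = 1) :
    deltaC w (cassiniArc w r ε θ) = (r : ℂ) ^ 2 * Complex.exp (θ * Complex.I) := by
  set q : ℂ := (w.im : ℂ) ^ 2 - (r : ℂ) ^ 2 * Complex.exp (θ * Complex.I) with hq
  have h1 : (q ^ (1 / 2 : ℂ)) ^ 2 = q := by
    simp
  have h2 : ((ε : ℂ)) ^ 2 = 1 := by exact_mod_cast hε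
  have hw : w = w.re + w.im * Complex.I := (Complex.re_add_im w).symm
  have hc : conj w = w.re - w.im * Complex.I := by
    apply Complex.ext <;> simp
  have h3 : deltaC w (cassiniArc w r ε θ)
      = (ε : ℂ) ^ 2 * Complex.I ^ 2 * (q ^ (1 / 2 : ℂ)) ^ 2 - Complex.I ^ 2 * (w.im : ℂ) ^ 2 := by
    rw [deltaC, hc]
    nth_rewrite 2 [hw]
    rw [cassiniArc, ← hq]
    ring
  rw [h3, h1, h2, Complex.I_sq, hq]
  ring

/-- The integral `∫ ω(ζ, dζ)` over the positively oriented boundary of the Cassini ball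
`cassiniBallC w r`, for a form `ω(ζ, dζ)` that is real linear in the differential `dζ`. -/
def cassiniIntegral {E : Type*} [NormedAddCommGroup E] [NormedSpace ℝ E]
    (w : ℂ) (r : ℝ) (ω : ℂ → ℂ → E) : E :=
  (∫ θ in (0 : ℝ)..(2 * Real.pi), ω (cassiniArc w r 1 θ) (deriv (cassiniArc w r 1) θ)) +
    ∫ θ in (0 : ℝ)..(2 * Real.pi), ω (cassiniArc w r (-1) θ) (deriv (cassiniArc w r (-1)) θ)

section Remainder

variable {A : Type*} [NormedNonAssocRing A] [NormedSpace ℝ A] [StarRing A]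

/-- The form `S_{y,n+1}(ζ)⁻¹ dζ f(ζ)` at `ζ = Φ_J(u)`, `dζ = Φ_J(v)`. -/
def coeffForm (J y : A) (f : A → A) (n : ℕ) (u v : ℂ) : A :=
  coneInv (sphPoly y (n + 1) (Phi J u)) * Phi J v * f (Phi J u)

/-- The form `Δ_ζ(z)⁻¹ (ζᶜ - z) J⁻¹ S_{y,n+1}(ζ)⁻¹ dζ f(ζ)` at `ζ = Φ_J(u)`, `dζ = Φ_J(v)`, with
values in the complexification; here `Δ_ζ(z) = Δ_u(z)` is a complex number. -/
def remForm (J y : A) (f : A → A) (n : ℕ) (z u v : ℂ) : Cx A :=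
  Cx.ofC (deltaC u z)⁻¹ * (Cx.ofA (star (Phi J u)) - Cx.ofC z) * Cx.ofA (coneInv J) *
    Cx.ofA (coneInv (sphPoly y (n + 1) (Phi J u))) * Cx.ofA (Phi J v) * Cx.ofA (f (Phi J u))

/-- The stem function `z ↦ ∫ Δ_ζ(z)⁻¹ (ζᶜ - z) J⁻¹ S_{y,n+1}(ζ)⁻¹ dζ f(ζ)` of the remainder, the
integral being taken over the boundary of `Ω_A(y, r) ∩ ℂ_J`, where `y = Φ_J(w)`. -/
def remStem (J y : A) (w : ℂ) (r : ℝ) (f : A → A) (n : ℕ) (z : ℂ) : Cx A :=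
  ⟨cassiniIntegral w r fun u v => (remForm J y f n z u v).re,
    cassiniIntegral w r fun u v => (remForm J y f n z u v).im⟩

/-- The form `Δ_ζ(x)⁻¹ (ζᶜ - x) J⁻¹ S_{y,n+1}(ζ)⁻¹ dζ f(ζ)` at `ζ = Φ_J(u)`, `dζ = Φ_J(v)`, for a
point `x` of the quadratic cone. -/
def remFormAssoc (J y : A) (f : A → A) (n : ℕ) (x : A) (u v : ℂ) : A :=
  coneInv (charPoly (Phi J u) x) * (star (Phi J u) - x) * coneInv J *
    coneInv (sphPoly y (n + 1) (Phi J u)) * Phi J v * f (Phi J u)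

/-- `S_f`, the supremum of `‖f‖` on the boundary of `Ω_A(y, r) ∩ ℂ_J`. -/
def supBoundary (f : A → A) (J y : A) (r : ℝ) : ℝ :=
  sSup ((fun ζ => ‖f ζ‖) '' cassiniBoundary J y r)

end Remainder

end SliceReg

end

/-! Fix `J`. By alternativity `J (J x) = -x`, so left multiplication by `Phi J c` makes `A` a
complex vector space, although `A` need not be associative. The Cauchy–Riemann equations for the
stem function say that `g(u) = f(Phi J u)` is holomorphic for this structure. The functionals
`testFun J φ` are complex linear and separate points, so scalar function theory applies to `g`.

On one slice the expansion is Newton interpolation at the nodes w, w̄, w, w̄, …. With p_n the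
product of the first n factors (`nodePoly`) and a_n the next node, one has 1/((ζ - z) p_n(ζ)) =
1/p_{n+1}(ζ) + (z - a_n)/((ζ - z) p_{n+1}(ζ)). Integrated against `g` and iterated from Cauchy's
formula (`cassiniIntegral_cauchy`, `remInt_eq`, `sub_sum_eq_remInt`), this yields the coefficients
and the exact remainder. The representation formula `rep` carries both to every other slice, since a
slice function is determined by its values at z and z̄ on the slice of `J`.

Cauchy's formula on the possibly singular or disconnected lemniscate |Δ_w| = r² comes from the
substitution T = Δ_w(ζ) = (ζ - ξ)² + η², where w = ξ + iη. The sum over the two roots is a function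
of T on the disc |T| ≤ r², continuous there and holomorphic off the branch value η², so Cauchy's
theorem for a disc with one exceptional point suffices.

The constants are uniform because |dζ| / |p_{n+1}(ζ)| ≤ (1 + σ(θ)/2) dθ / r^n on each arc, with an
integrable weight σ (`arcWeight`) that depends on neither w nor r (`norm_deriv_div_nodePoly_le`).
Uniqueness follows by letting z tend to w to kill the first coefficient, then dividing by z - w,
which exchanges w and w̄ (`coeff_eq_zero`). -/

namespace SliceReg

/-! ### The lemniscate -/

section Lemniscate

open MeasureTheory

/-- The level set `|Δ_w| = r²`. -/
def lemniscate (w : ℂ) (r : ℝ) : Set ℂ := {u | ‖deltaC w u‖ = r ^ 2}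

theorem deltaC_eq (w z : ℂ) : deltaC w z = (z - w.re) ^ 2 + (w.im : ℂ) ^ 2 := by
  rw [deltaC]
  have h1 : w + conj w = 2 * w.re := by apply Complex.ext <;> simp; ring
  have h2 : w * conj w = (w.re : ℂ) ^ 2 + (w.im : ℂ) ^ 2 := by
    apply Complex.ext <;> simp [pow_two]; ring
  linear_combination (-z) * h1 + h2

theorem continuous_deltaC (w : ℂ) : Continuous (deltaC w) := by
  unfold deltaC; fun_prop

theorem deltaC_conj_left (w z : ℂ) : deltaC (conj w) z = deltaC w z := by
  simp [deltaC, mul_comm]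

theorem deltaC_conj (w z : ℂ) : deltaC w (conj z) = conj (deltaC w z) := by
  simp [deltaC, mul_comm]

theorem mem_cassiniBallC {w z : ℂ} {r : ℝ} (hr : 0 < r) :
    z ∈ cassiniBallC w r ↔ ‖deltaC w z‖ < r ^ 2 := by
  rw [cassiniBallC, mem_ofPred_eq, Real.sqrt_lt' hr]

theorem conj_mem_cassiniBallC {w z : ℂ} {r : ℝ} (h : z ∈ cassiniBallC w r) :
    conj z ∈ cassiniBallC w r := by
  simpa [cassiniBallC, deltaC_conj] using h

theorem isOpen_cassiniBallC (w : ℂ) (r : ℝ) : IsOpen (cassiniBallC w r) :=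
  isOpen_lt (Real.continuous_sqrt.comp (continuous_deltaC w).norm) continuous_const

theorem isCompact_lemniscate (w : ℂ) (r : ℝ) : IsCompact (lemniscate w r) := by
  refine Metric.isCompact_of_isClosed_isBounded
    (isClosed_eq (continuous_deltaC w).norm continuous_const) ?_
  refine (Metric.isBounded_closedBall (x := (w.re : ℂ)) (r := |r| + |w.im|)).subset fun u hu => ?_
  rw [mem_closedBall_iff_norm]
  refine abs_le_of_sq_le_sq' ?_ (by positivity) |>.2
  have h1 : ‖(u - w.re) ^ 2‖ ≤ ‖deltaC w u‖ + ‖(w.im : ℂ) ^ 2‖ := by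
    rw [deltaC_eq]; exact norm_le_add_norm_add _ _
  have h2 : ‖deltaC w u‖ = r ^ 2 := hu
  rw [h2, norm_pow, norm_pow, Complex.norm_real, Real.norm_eq_abs, sq_abs] at h1
  nlinarith [sq_abs r, sq_abs w.im, mul_nonneg (abs_nonneg r) (abs_nonneg w.im)]

/-- The open mapping theorem for Δ_w: arbitrarily close to u there are points with value x Δ_w(u), 0
< x < 1, and these lie in the ball. It applies also at the double point of the lemniscate. -/
theorem lemniscate_subset_frontier {w : ℂ} {r : ℝ} (hr : 0 < r) :
    lemniscate w r ⊆ frontier (cassiniBallC w r) := by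
  intro u hu
  have hu' : ‖deltaC w u‖ = r ^ 2 := hu
  rw [frontier, (isOpen_cassiniBallC w r).interior_eq]
  refine ⟨?_, fun h => ?_⟩
  · rw [mem_closure_iff_nhds]
    intro s hs
    have han : AnalyticOnNhd ℂ (deltaC w) univ := by
      intro z _
      refine DifferentiableOn.analyticAt (s := univ) ?_ univ_mem
      unfold deltaC
      fun_prop
    rcases han.is_constant_or_isOpen isPreconnected_univ with ⟨c, hc⟩ | h
    · exfalso
      have h0 := hc w (mem_univ _)
      have h1 := hc u (mem_univ _)
      rw [h1, ← h0] at hu'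
      have : deltaC w w = 0 := by simp [deltaC]
      rw [this, norm_zero] at hu'
      exact (pow_pos hr 2).ne hu'
    · obtain ⟨t, hts, ht, hut⟩ := mem_nhds_iff.1 hs
      have h1 := (h t (subset_univ _) ht).mem_nhds (mem_image_of_mem _ hut)
      have h2 : Tendsto (fun x : ℝ => (x : ℂ) * deltaC w u) (𝓝[<] 1) (𝓝 (deltaC w u)) := by
        have : Continuous fun x : ℝ => (x : ℂ) * deltaC w u := by fun_prop
        have h3 := this.tendsto 1
        rw [Complex.ofReal_one, one_mul] at h3
        exact h3.mono_left nhdsWithin_le_nhds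
      have h4 : ∀ᶠ x : ℝ in 𝓝[<] 1, x ∈ Ioo (0 : ℝ) 1 := Ioo_mem_nhdsLT one_pos
      obtain ⟨x, ⟨z, hz, hzx⟩, hx⟩ := ((h2.eventually h1).and h4).exists
      refine ⟨z, hts hz, (mem_cassiniBallC hr).2 ?_⟩
      rw [hzx, norm_mul, hu', Complex.norm_real, Real.norm_eq_abs, abs_of_pos hx.1]
      nlinarith [hx.2, pow_pos hr 2]
  · rw [mem_cassiniBallC hr, hu'] at h
    exact lt_irrefl _ h

theorem cassiniArc_mem (w : ℂ) (r : ℝ) {ε : ℝ} (hε : ε ^ 2 = 1) (θ : ℝ) :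
    cassiniArc w r ε θ ∈ lemniscate w r := by
  rw [lemniscate, mem_ofPred_eq, deltaC_cassiniArc w r ε θ hε, norm_mul, norm_pow,
    Complex.norm_exp_ofReal_mul_I, Complex.norm_real, Real.norm_eq_abs, sq_abs, mul_one]

theorem cassiniArc_sub_sq (w : ℂ) (r : ℝ) {ε : ℝ} (hε : ε ^ 2 = 1) (θ : ℝ) :
    (cassiniArc w r ε θ - w.re) ^ 2 =
      (r : ℂ) ^ 2 * Complex.exp (θ * Complex.I) - (w.im : ℂ) ^ 2 := by
  rw [← deltaC_cassiniArc w r ε θ hε, deltaC_eq]; ring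

/-- The distance from b e^{iθ} to the ray of nonnegative reals is b |sin θ| or b, according to the
sign of cos θ, and both dominate b sin(θ/2). The bound does not involve a; with a = η² and b = r² it
controls the arcs uniformly in w. -/
theorem le_norm_sub_circle {a b : ℝ} (ha : 0 ≤ a) (hb : 0 ≤ b) (θ : ℝ) :
    b * Real.sin (θ / 2) ≤ ‖(b : ℂ) * Complex.exp (θ * Complex.I) - a‖ := by
  refine abs_le_of_sq_le_sq' ?_ (norm_nonneg _) |>.2
  rw [Complex.sq_norm, Complex.normSq_apply, Complex.exp_mul_I]
  have hc : Real.sin (θ / 2) ^ 2 = (1 - Real.cos θ) / 2 := by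
    rw [Real.sin_sq_eq_half_sub]; ring_nf
  have hs := Real.sin_sq_add_cos_sq θ
  simp only [Complex.sub_re, Complex.sub_im,
    Complex.add_re, Complex.add_im, Complex.cos_ofReal_re, Complex.cos_ofReal_im,
    Complex.sin_ofReal_re, Complex.sin_ofReal_im, Complex.mul_re, Complex.mul_im, Complex.I_re,
    Complex.I_im, Complex.ofReal_re, Complex.ofReal_im]
  have h1 := Real.cos_le_one θ
  have h2 := Real.neg_one_le_cos θ
  rw [mul_pow, hc]
  generalize Real.cos θ = c at *
  generalize Real.sin θ = s at *
  have hs' : s ^ 2 = 1 - c ^ 2 := by linarith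
  have : b ^ 2 * ((1 - c) / 2) ≤ (b * c - a) ^ 2 + b ^ 2 * s ^ 2 := by
    rw [hs']
    rcases le_total 0 c with h | h
    · have : 0 ≤ b ^ 2 * (1 / 2 + c / 2 - c ^ 2) := by
        apply mul_nonneg (sq_nonneg _); nlinarith
      nlinarith [sq_nonneg (b * c - a)]
    · have : 0 ≤ a * b * (-c) := mul_nonneg (mul_nonneg ha hb) (by linarith)
      have : 0 ≤ b ^ 2 * (1 + c) := mul_nonneg (sq_nonneg _) (by linarith)
      nlinarith [sq_nonneg a]
  nlinarith [this]

/-- The function which dominates the speed of the arcs of the lemniscate. -/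
noncomputable def arcWeight (θ : ℝ) : ℝ := (Real.sqrt (Real.sin (θ / 2)))⁻¹

theorem sin_half_pos {θ : ℝ} (h : θ ∈ Ioo 0 (2 * Real.pi)) : 0 < Real.sin (θ / 2) :=
  Real.sin_pos_of_pos_of_lt_pi (by linarith [h.1]) (by linarith [h.2])

theorem le_norm_cassiniArc_sub (w : ℂ) (r : ℝ) {ε : ℝ} (hε : ε ^ 2 = 1) {θ : ℝ}
    (hθ : θ ∈ Ioo 0 (2 * Real.pi)) :
    r * Real.sqrt (Real.sin (θ / 2)) ≤ ‖cassiniArc w r ε θ - w.re‖ := by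
  refine abs_le_of_sq_le_sq' ?_ (norm_nonneg _) |>.2
  rw [mul_pow, Real.sq_sqrt (sin_half_pos hθ).le, ← norm_pow, cassiniArc_sub_sq w r hε]
  have := le_norm_sub_circle (sq_nonneg w.im) (sq_nonneg r) θ
  simpa using this

theorem cassiniArc_sub_ne_zero (w : ℂ) {r : ℝ} (hr : 0 < r) {ε : ℝ} (hε : ε ^ 2 = 1) {θ : ℝ}
    (hθ : θ ∈ Ioo 0 (2 * Real.pi)) : cassiniArc w r ε θ - w.re ≠ 0 := by
  have := le_norm_cassiniArc_sub w r hε hθ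
  have h2 : 0 < r * Real.sqrt (Real.sin (θ / 2)) :=
    mul_pos hr (Real.sqrt_pos.2 (sin_half_pos hθ))
  exact norm_pos_iff.1 (h2.trans_le this)

/-- The number has imaginary part -r² sin θ, which vanishes in the open interval only at θ = π;
there the value is η² + r² > 0. -/
theorem cassiniArc_slitPlane (w : ℂ) {r : ℝ} (hr : 0 < r) {θ : ℝ}
    (hθ : θ ∈ Ioo 0 (2 * Real.pi)) :
    (w.im : ℂ) ^ 2 - (r : ℂ) ^ 2 * Complex.exp (θ * Complex.I) ∈ Complex.slitPlane := by
  rw [Complex.mem_slitPlane_iff]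
  have e1 : ((w.im : ℂ) ^ 2 - (r : ℂ) ^ 2 * Complex.exp (θ * Complex.I)).im
      = - (r ^ 2 * Real.sin θ) := by
    rw [Complex.exp_mul_I]
    simp [← Complex.ofReal_pow, ← Complex.ofReal_cos, ← Complex.ofReal_sin]
  have e2 : ((w.im : ℂ) ^ 2 - (r : ℂ) ^ 2 * Complex.exp (θ * Complex.I)).re
      = w.im ^ 2 - (r ^ 2 * Real.cos θ) := by
    rw [Complex.exp_mul_I]
    simp [← Complex.ofReal_pow, ← Complex.ofReal_cos, ← Complex.ofReal_sin]
  rw [e1, e2]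
  by_cases hs : Real.sin θ = 0
  · left
    have h1 : Real.cos θ = -1 := by
      have h2 := Real.sin_sq_add_cos_sq θ
      have h3 : (Real.cos θ - 1) * (Real.cos θ + 1) = 0 := by rw [hs] at h2; linarith
      rcases mul_eq_zero.1 h3 with h | h
      · have h4 := sin_half_pos hθ
        have h5 := Real.sin_sq_eq_half_sub (θ / 2)
        rw [mul_div_cancel₀ _ two_ne_zero] at h5
        nlinarith
      · linarith
    rw [h1]; nlinarith [sq_nonneg w.im, pow_pos hr 2]
  · right
    simp [hs, hr.ne']

theorem hasDerivAt_cassiniArc (w : ℂ) {r : ℝ} (hr : 0 < r) {ε : ℝ} (hε : ε ^ 2 = 1) {θ : ℝ}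
    (hθ : θ ∈ Ioo 0 (2 * Real.pi)) :
    HasDerivAt (cassiniArc w r ε)
      (Complex.I * ((r : ℂ) ^ 2 * Complex.exp (θ * Complex.I)) /
        (2 * (cassiniArc w r ε θ - w.re))) θ := by
  have h0 := cassiniArc_sub_ne_zero w hr hε hθ
  have hsl := cassiniArc_slitPlane w hr hθ
  set q : ℂ := (w.im : ℂ) ^ 2 - (r : ℂ) ^ 2 * Complex.exp (θ * Complex.I) with hq
  have h1 : HasDerivAt (fun t : ℝ => (w.im : ℂ) ^ 2 - (r : ℂ) ^ 2 * Complex.exp (t * Complex.I))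
      (-((r : ℂ) ^ 2 * (Complex.exp (θ * Complex.I) * Complex.I))) θ := by
    have h2 : HasDerivAt (fun t : ℝ => (t : ℂ) * Complex.I) Complex.I θ := by
      simpa using (HasDerivAt.ofReal_comp (hasDerivAt_id θ)).mul_const Complex.I
    simpa using ((h2.cexp).const_mul ((r : ℂ) ^ 2)).const_sub ((w.im : ℂ) ^ 2)
  have h2 := ((Complex.hasStrictDerivAt_cpow_const (c := (1 / 2 : ℂ)) hsl).hasDerivAt.comp θ h1)
  have h3 := ((h2.const_mul ((ε : ℂ) * Complex.I)).const_add (w.re : ℂ))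
  have e1 : cassiniArc w r ε θ - w.re = ε * Complex.I * q ^ (1 / 2 : ℂ) := by
    rw [cassiniArc, ← hq]; ring
  refine h3.congr_deriv ?_
  have hq0 : q ≠ 0 := Complex.slitPlane_ne_zero hsl
  have hqq : q ^ (1 / 2 : ℂ) * q ^ (1 / 2 : ℂ) = q := by
    rw [← Complex.cpow_add _ _ hq0]; norm_num
  have hq2 : q ^ (1 / 2 : ℂ) ≠ 0 := by
    intro h; rw [h] at hqq; simp at hqq; exact hq0 hqq.symm
  have h4 : q ^ ((1 / 2 : ℂ) - 1) = (q ^ (1 / 2 : ℂ))⁻¹ := by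
    rw [← Complex.cpow_neg]; norm_num
  have hε0 : (ε : ℂ) ^ 2 = 1 := by exact_mod_cast hε
  have hε1 : (ε : ℂ) ≠ 0 := by
    intro h; rw [h] at hε0; simp at hε0
  rw [e1, h4]
  field_simp
  rw [hε0, Complex.I_sq]
  ring

theorem norm_deriv_cassiniArc (w : ℂ) {r : ℝ} (hr : 0 < r) {ε : ℝ} (hε : ε ^ 2 = 1) {θ : ℝ}
    (hθ : θ ∈ Ioo 0 (2 * Real.pi)) :
    ‖deriv (cassiniArc w r ε) θ‖ = r ^ 2 / (2 * ‖cassiniArc w r ε θ - w.re‖) := by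
  rw [(hasDerivAt_cassiniArc w hr hε hθ).deriv]
  simp [Complex.norm_exp_ofReal_mul_I]

theorem norm_deriv_cassiniArc_le (w : ℂ) {r : ℝ} (hr : 0 < r) {ε : ℝ} (hε : ε ^ 2 = 1) {θ : ℝ}
    (hθ : θ ∈ Ioo 0 (2 * Real.pi)) :
    ‖deriv (cassiniArc w r ε) θ‖ ≤ r * (arcWeight θ / 2) := by
  have h1 := le_norm_cassiniArc_sub w r hε hθ
  have h2 := Real.sqrt_pos.2 (sin_half_pos hθ)
  rw [norm_deriv_cassiniArc w hr hε hθ, arcWeight]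
  calc r ^ 2 / (2 * ‖cassiniArc w r ε θ - w.re‖)
      ≤ r ^ 2 / (2 * (r * Real.sqrt (Real.sin (θ / 2)))) := by gcongr
    _ = _ := by field_simp

theorem arcWeight_pos {θ : ℝ} (hθ : θ ∈ Ioo 0 (2 * Real.pi)) : 0 < arcWeight θ :=
  inv_pos.2 (Real.sqrt_pos.2 (sin_half_pos hθ))

theorem intervalIntegrable_arcWeight_aux : IntervalIntegrable arcWeight volume 0 Real.pi := by
  have h := (intervalIntegral.intervalIntegrable_rpow' (a := 0) (b := Real.pi) (r := -(1 / 2))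
    (by norm_num)).const_mul (Real.sqrt Real.pi)
  refine h.mono_fun ?_ ?_
  · apply Measurable.aestronglyMeasurable
    unfold arcWeight
    fun_prop
  · rw [uIoc_of_le Real.pi_pos.le]
    filter_upwards [ae_restrict_mem measurableSet_Ioc] with θ hθ
    -- Jordan's inequality: the weight is at most a multiple of θ^(-1/2), which is integrable at 0.
    have h1 : 2 / Real.pi * (θ / 2) ≤ Real.sin (θ / 2) :=
      Real.mul_le_sin (by linarith [hθ.1]) (by linarith [hθ.2])
    have h2 : 0 < θ / Real.pi := div_pos hθ.1 Real.pi_pos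
    have h3 : θ / Real.pi ≤ Real.sin (θ / 2) := by
      refine le_trans (le_of_eq ?_) h1; field_simp
    have h4 : Real.sqrt (θ / Real.pi) ≤ Real.sqrt (Real.sin (θ / 2)) := Real.sqrt_le_sqrt h3
    have h5 : 0 < Real.sqrt (θ / Real.pi) := Real.sqrt_pos.2 h2
    rw [arcWeight, Real.norm_of_nonneg (by positivity), Real.norm_of_nonneg
      (mul_nonneg (Real.sqrt_nonneg _) (Real.rpow_nonneg hθ.1.le _)), Real.rpow_neg hθ.1.le,
      ← Real.sqrt_eq_rpow]
    calc (Real.sqrt (Real.sin (θ / 2)))⁻¹ ≤ (Real.sqrt (θ / Real.pi))⁻¹ := by gcongr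
      _ = _ := by rw [Real.sqrt_div hθ.1.le, inv_div, div_eq_mul_inv]

theorem intervalIntegrable_arcWeight :
    IntervalIntegrable arcWeight volume 0 (2 * Real.pi) := by
  have h := intervalIntegrable_arcWeight_aux
  refine h.trans (b := Real.pi) ?_
  have h2 := (h.comp_sub_left (2 * Real.pi)).symm
  -- The symmetry θ ↦ 2π - θ carries the integrability from the first half of the interval to the
  -- second.
  have e : (fun x => arcWeight (2 * Real.pi - x)) = arcWeight := by
    funext x
    rw [arcWeight, arcWeight, sub_div, mul_div_cancel_left₀ _ two_ne_zero, Real.sin_pi_sub]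
  rw [e] at h2
  convert h2 using 1 <;> ring

end Lemniscate

end SliceReg
namespace SliceReg

/-! ### Integration of forms along the lemniscate and the uniform weight bound -/

section Forms

open MeasureTheory

variable {E F : Type*} [NormedAddCommGroup E] [NormedSpace ℝ E] [NormedAddCommGroup F]
  [NormedSpace ℝ F]

/-- Forms `ω(ζ, dζ)` on `K`, real linear in `dζ`, with continuous coefficients. -/
def IsRegularForm (K : Set ℂ) (ω : ℂ → ℂ → E) : Prop :=
  ∃ a b : ℂ → E, ContinuousOn a K ∧ ContinuousOn b K ∧
    ∀ u ∈ K, ∀ v, ω u v = v.re • a u + v.im • b u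

theorem IsRegularForm.clm {K : Set ℂ} {ω : ℂ → ℂ → E} (h : IsRegularForm K ω) (L : E →L[ℝ] F) :
    IsRegularForm K fun u v => L (ω u v) := by
  obtain ⟨a, b, ha, hb, he⟩ := h
  refine ⟨fun u => L (a u), fun u => L (b u), L.continuous.comp_continuousOn ha,
    L.continuous.comp_continuousOn hb, fun u hu v => ?_⟩
  simp only [he u hu, map_add, map_smul]

theorem isRegularForm_mul {K : Set ℂ} {k : ℂ → ℂ} (hk : ContinuousOn k K) :
    IsRegularForm K fun u v => k u * v := by
  refine ⟨k, fun u => k u * Complex.I, hk, hk.mul continuousOn_const, fun u _ v => ?_⟩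
  nth_rewrite 1 [← Complex.re_add_im v]
  simp only [Complex.real_smul]
  ring

theorem continuousOn_deriv_cassiniArc (w : ℂ) {r : ℝ} (hr : 0 < r) {ε : ℝ} (hε : ε ^ 2 = 1) :
    ContinuousOn (cassiniArc w r ε) (Ioo 0 (2 * Real.pi)) ∧
      ContinuousOn (deriv (cassiniArc w r ε)) (Ioo 0 (2 * Real.pi)) := by
  have h1 : ContinuousOn (cassiniArc w r ε) (Ioo 0 (2 * Real.pi)) := fun θ hθ =>
    (hasDerivAt_cassiniArc w hr hε hθ).continuousAt.continuousWithinAt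
  refine ⟨h1, ContinuousOn.congr ?_ fun θ hθ => (hasDerivAt_cassiniArc w hr hε hθ).deriv⟩
  refine ContinuousOn.div (by fun_prop) (by fun_prop) fun θ hθ => ?_
  exact mul_ne_zero two_ne_zero (cassiniArc_sub_ne_zero w hr hε hθ)

/-- The derivative formula for the arcs is available only in the open interval, so the end point is
discarded as a null set. -/
theorem ae_uIoc_Ioo : ∀ᵐ θ : ℝ, θ ∈ uIoc 0 (2 * Real.pi) → θ ∈ Ioo 0 (2 * Real.pi) := by
  have : ∀ᵐ θ : ℝ, θ ≠ 2 * Real.pi := by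
    simp [ae_iff]
  filter_upwards [this] with θ h1 h2
  rw [uIoc_of_le Real.two_pi_pos.le] at h2
  exact ⟨h2.1, lt_of_le_of_ne h2.2 h1⟩

/-- The coefficients are bounded on the compact lemniscate, and the speed of the arc is dominated by
a multiple of the integrable weight, even when the curve passes through its double point. -/
theorem IsRegularForm.intervalIntegrable {w : ℂ} {r : ℝ} (hr : 0 < r) {ω : ℂ → ℂ → E}
    (h : IsRegularForm (lemniscate w r) ω) {ε : ℝ} (hε : ε ^ 2 = 1) :
    IntervalIntegrable (fun θ => ω (cassiniArc w r ε θ) (deriv (cassiniArc w r ε) θ)) volume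
      0 (2 * Real.pi) := by
  obtain ⟨a, b, ha, hb, he⟩ := h
  obtain ⟨c1, c2⟩ := continuousOn_deriv_cassiniArc w hr hε
  obtain ⟨A, hA⟩ := (isCompact_lemniscate w r).exists_bound_of_continuousOn ha
  obtain ⟨B, hB⟩ := (isCompact_lemniscate w r).exists_bound_of_continuousOn hb
  have hm : MapsTo (cassiniArc w r ε) (Ioo 0 (2 * Real.pi)) (lemniscate w r) :=
    fun θ _ => cassiniArc_mem w r hε θ
  refine (intervalIntegrable_arcWeight.const_mul (r / 2 * (A + B))).mono_fun ?_ ?_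
  · rw [uIoc_of_le Real.two_pi_pos.le, ← restrict_Ioo_eq_restrict_Ioc]
    refine ContinuousOn.aestronglyMeasurable ?_ measurableSet_Ioo
    refine ContinuousOn.congr (f := fun θ => (deriv (cassiniArc w r ε) θ).re •
      a (cassiniArc w r ε θ) + (deriv (cassiniArc w r ε) θ).im • b (cassiniArc w r ε θ)) ?_
      fun θ _ => he _ (cassiniArc_mem w r hε θ) _
    exact ((Complex.continuous_re.comp_continuousOn c2).smul (ha.comp c1 hm)).add
      ((Complex.continuous_im.comp_continuousOn c2).smul (hb.comp c1 hm))
  · rw [EventuallyLE, ae_restrict_iff' measurableSet_uIoc]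
    filter_upwards [ae_uIoc_Ioo] with θ h0 h1
    have hθ := h0 h1
    have hu := cassiniArc_mem w r hε θ
    have hv := norm_deriv_cassiniArc_le w hr hε hθ
    have hw := arcWeight_pos hθ
    rw [he _ hu]
    set u := cassiniArc w r ε θ
    set v := deriv (cassiniArc w r ε) θ
    calc ‖v.re • a u + v.im • b u‖ ≤ ‖v‖ * A + ‖v‖ * B := by
          refine norm_add_le_of_le ?_ ?_
          · rw [norm_smul]
            exact mul_le_mul (Complex.abs_re_le_norm v) (hA u hu) (norm_nonneg _) (norm_nonneg _)
          · rw [norm_smul]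
            exact mul_le_mul (Complex.abs_im_le_norm v) (hB u hu) (norm_nonneg _) (norm_nonneg _)
      _ = ‖v‖ * (A + B) := by ring
      _ ≤ r * (arcWeight θ / 2) * (A + B) := by
          gcongr
          exact add_nonneg ((norm_nonneg _).trans (hA u hu)) ((norm_nonneg _).trans (hB u hu))
      _ ≤ ‖r / 2 * (A + B) * arcWeight θ‖ := by
          refine le_trans (le_of_eq ?_) (le_abs_self _); ring

theorem cassiniIntegral_congr {w : ℂ} {r : ℝ} {ω ω' : ℂ → ℂ → E}
    (e : ∀ u ∈ lemniscate w r, ∀ v, ω u v = ω' u v) :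
    cassiniIntegral w r ω = cassiniIntegral w r ω' := by
  unfold cassiniIntegral
  congr 1 <;> refine intervalIntegral.integral_congr fun θ _ => ?_
  · exact e _ (cassiniArc_mem w r (by norm_num) θ) _
  · exact e _ (cassiniArc_mem w r (by norm_num) θ) _

theorem cassiniIntegral_add {w : ℂ} {r : ℝ} (hr : 0 < r) {ω ω' : ℂ → ℂ → E}
    (h : IsRegularForm (lemniscate w r) ω) (h' : IsRegularForm (lemniscate w r) ω') :
    cassiniIntegral w r (fun u v => ω u v + ω' u v) =
      cassiniIntegral w r ω + cassiniIntegral w r ω' := by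
  unfold cassiniIntegral
  rw [intervalIntegral.integral_add (h.intervalIntegrable hr (by norm_num))
      (h'.intervalIntegrable hr (by norm_num)),
    intervalIntegral.integral_add (h.intervalIntegrable hr (by norm_num))
      (h'.intervalIntegrable hr (by norm_num))]
  abel

theorem cassiniIntegral_neg (w : ℂ) (r : ℝ) (ω : ℂ → ℂ → E) :
    cassiniIntegral w r (fun u v => -ω u v) = -cassiniIntegral w r ω := by
  simp only [cassiniIntegral, intervalIntegral.integral_neg, neg_add]

theorem cassiniIntegral_clm [CompleteSpace E] [CompleteSpace F] {w : ℂ} {r : ℝ} (hr : 0 < r)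
    {ω : ℂ → ℂ → E} (h : IsRegularForm (lemniscate w r) ω) (L : E →L[ℝ] F) :
    cassiniIntegral w r (fun u v => L (ω u v)) = L (cassiniIntegral w r ω) := by
  unfold cassiniIntegral
  rw [map_add, ← L.intervalIntegral_comp_comm (h.intervalIntegrable hr (by norm_num)),
    ← L.intervalIntegral_comp_comm (h.intervalIntegrable hr (by norm_num))]

/-- The product of the first `n` factors of `(z - w), (z - w̄), (z - w), …`. -/
noncomputable def nodePoly (w : ℂ) (n : ℕ) (z : ℂ) : ℂ :=
  deltaC w z ^ (n / 2) * if Even n then 1 else z - w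

theorem nodePoly_zero (w z : ℂ) : nodePoly w 0 z = 1 := by simp [nodePoly]

theorem nodePoly_succ' (w : ℂ) (n : ℕ) (z : ℂ) :
    nodePoly w (n + 1) z = nodePoly w n z * if Even n then z - w else z - conj w := by
  rcases Nat.even_or_odd' n with ⟨m, rfl | rfl⟩
  · have h1 : (2 * m + 1) / 2 = m := by omega
    have h2 : (2 * m) / 2 = m := by omega
    simp [nodePoly, h1, h2]
  · have h1 : (2 * m + 1 + 1) / 2 = m + 1 := by omega
    have h2 : (2 * m + 1) / 2 = m := by omega
    have h3 : Even (2 * m + 1 + 1) := ⟨m + 1, by ring⟩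
    have h4 : ¬ Even (2 * m + 1) := by simp
    rw [nodePoly, nodePoly, h1, h2, if_pos h3, if_neg h4, if_neg h4, pow_succ, deltaC]
    ring

/-- Here the first node is split off, where `nodePoly_succ'` splits off the last; the remaining
nodes then start at w̄. Uniqueness rests on this form. -/
theorem nodePoly_succ (w : ℂ) (n : ℕ) (z : ℂ) :
    nodePoly w (n + 1) z = (z - w) * nodePoly (conj w) n z := by
  rcases Nat.even_or_odd' n with ⟨m, rfl | rfl⟩
  · have h1 : (2 * m + 1) / 2 = m := by omega
    have h2 : (2 * m) / 2 = m := by omega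
    have h3 : ¬ Even (2 * m + 1) := by simp
    rw [nodePoly, nodePoly, h1, h2, if_neg h3, if_pos (even_two_mul m), deltaC_conj_left]
    ring
  · have h1 : (2 * m + 1 + 1) / 2 = m + 1 := by omega
    have h2 : (2 * m + 1) / 2 = m := by omega
    have h3 : Even (2 * m + 1 + 1) := ⟨m + 1, by ring⟩
    have h4 : ¬ Even (2 * m + 1) := by simp
    rw [nodePoly, nodePoly, h1, h2, if_pos h3, if_neg h4, pow_succ, deltaC_conj_left]
    simp only [deltaC]
    ring

theorem continuous_nodePoly (w : ℂ) (n : ℕ) : Continuous (nodePoly w n) := by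
  have := continuous_deltaC w
  unfold nodePoly
  split_ifs <;> fun_prop

theorem nodePoly_ne_zero {w z : ℂ} (h : deltaC w z ≠ 0) (n : ℕ) : nodePoly w n z ≠ 0 := by
  rw [nodePoly]
  refine mul_ne_zero (pow_ne_zero _ h) ?_
  split_ifs
  · exact one_ne_zero
  · exact left_ne_zero_of_mul h

theorem deltaC_ne_zero_of_mem {w u : ℂ} {r : ℝ} (hr : 0 < r) (hu : u ∈ lemniscate w r) :
    deltaC w u ≠ 0 := by
  intro h
  have hu' : ‖deltaC w u‖ = r ^ 2 := hu
  rw [h, norm_zero] at hu'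
  exact (pow_pos hr 2).ne hu'

theorem norm_nodePoly_even {w z : ℂ} {t : ℝ} (ht : ‖deltaC w z‖ = t ^ 2) {n : ℕ} (hn : Even n) :
    ‖nodePoly w n z‖ = t ^ n := by
  obtain ⟨m, rfl⟩ := hn
  have h2 : (m + m) / 2 = m := by omega
  rw [nodePoly, if_pos ⟨m, rfl⟩, mul_one, norm_pow, ht, h2, ← pow_mul, two_mul]

theorem norm_nodePoly_odd {w z : ℂ} {t : ℝ} (ht : ‖deltaC w z‖ = t ^ 2) {n : ℕ} (hn : Even n) :
    ‖nodePoly w (n + 1) z‖ = t ^ n * ‖z - w‖ := by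
  rw [nodePoly_succ', if_pos hn, norm_mul, norm_nodePoly_even ht hn]

theorem norm_sub_re_conj (w z : ℂ) : ‖z - conj w‖ ≤ ‖z - w.re‖ + |w.im| ∧
    ‖z - w‖ ≤ ‖z - w.re‖ + |w.im| := by
  have e1 : z - conj w = (z - w.re) + w.im * Complex.I := by
    apply Complex.ext <;> simp
  have e2 : z - w = (z - w.re) - w.im * Complex.I := by
    apply Complex.ext <;> simp
  have h : ‖(w.im : ℂ) * Complex.I‖ = |w.im| := by simp
  constructor
  · rw [e1, ← h]; exact norm_add_le _ _
  · rw [e2, ← h]; exact norm_sub_le _ _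

theorem norm_sub_re_le {w z : ℂ} {t : ℝ} (ht0 : 0 ≤ t) (ht : ‖deltaC w z‖ ≤ t ^ 2) :
    ‖z - w.re‖ ≤ t + |w.im| ∧ |w.im| ≤ t + ‖z - w.re‖ := by
  rw [deltaC_eq] at ht
  have h0 : ‖(w.im : ℂ) ^ 2‖ = |w.im| ^ 2 := by simp
  have h1 : ‖(z - w.re) ^ 2‖ ≤ ‖(z - w.re) ^ 2 + (w.im : ℂ) ^ 2‖ + ‖(w.im : ℂ) ^ 2‖ :=
    norm_le_add_norm_add _ _
  have h2 : ‖(w.im : ℂ) ^ 2‖ ≤ ‖(z - w.re) ^ 2 + (w.im : ℂ) ^ 2‖ + ‖(z - w.re) ^ 2‖ :=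
    norm_le_add_norm_add' _ _
  rw [h0] at h1 h2
  rw [norm_pow] at h1
  rw [norm_pow (z - _)] at h2
  constructor
  · refine abs_le_of_sq_le_sq' ?_ (by positivity) |>.2
    nlinarith [mul_nonneg ht0 (abs_nonneg w.im)]
  · refine abs_le_of_sq_le_sq' ?_ (by positivity) |>.2
    nlinarith [mul_nonneg ht0 (norm_nonneg (z - w.re))]

/-- For odd n the denominator is r^(n+1) and the speed bound r σ/2 suffices. For even n it is r^n |ζ
- w|, and |ζ - w| may be far smaller than r. This factor cancels against the speed r²/(2|ζ - ξ|) =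
|ζ - w| |ζ - w̄|/(2|ζ - ξ|), and what remains is bounded through |ζ - w̄| ≤ 2|ζ - ξ| + r and r ≤ σ
|ζ - ξ|. -/
theorem norm_deriv_div_nodePoly_le (w : ℂ) {r : ℝ} (hr : 0 < r) {ε : ℝ} (hε : ε ^ 2 = 1) {θ : ℝ}
    (hθ : θ ∈ Ioo 0 (2 * Real.pi)) (n : ℕ) :
    ‖deriv (cassiniArc w r ε) θ‖ / ‖nodePoly w (n + 1) (cassiniArc w r ε θ)‖ ≤
      (1 + arcWeight θ / 2) / r ^ n := by
  have hu := cassiniArc_mem w r hε θ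
  have hd := deltaC_ne_zero_of_mem hr hu
  have hu' : ‖deltaC w (cassiniArc w r ε θ)‖ = r ^ 2 := hu
  have hv := norm_deriv_cassiniArc_le w hr hε hθ
  have hv' := norm_deriv_cassiniArc w hr hε hθ
  have hs := norm_pos_iff.2 (cassiniArc_sub_ne_zero w hr hε hθ)
  have hsr := le_norm_cassiniArc_sub w r hε hθ
  have hσ := arcWeight_pos hθ
  generalize deriv (cassiniArc w r ε) θ = v at *
  generalize cassiniArc w r ε θ = u at *
  rcases Nat.even_or_odd n with hn | hn
  · have hw1 : u - w ≠ 0 := left_ne_zero_of_mul hd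
    have hw2 : 0 < ‖u - w‖ := norm_pos_iff.2 hw1
    have h1 : ‖u - w‖ * ‖u - conj w‖ = r ^ 2 := by rw [← norm_mul]; exact hu'
    rw [norm_nodePoly_odd hu' hn, mul_comm, ← div_div]
    refine div_le_div_of_nonneg_right ?_ (by positivity)
    rw [hv', ← h1]
    have h2 := (norm_sub_re_conj w u).1
    have h3 := (norm_sub_re_le hr.le hu'.le).2
    have h4 : r ≤ arcWeight θ * ‖u - w.re‖ := by
      rw [arcWeight, ← div_eq_inv_mul, le_div_iff₀ (Real.sqrt_pos.2 (sin_half_pos hθ))]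
      exact hsr
    rw [div_div, mul_comm (2 * _), mul_div_mul_left _ _ hw2.ne', div_le_iff₀ (by positivity)]
    nlinarith
  · rw [norm_nodePoly_even hu' hn.add_one, pow_succ, mul_comm, ← div_div]
    refine div_le_div_of_nonneg_right ?_ (by positivity)
    rw [div_le_iff₀ hr]
    nlinarith

/-- A bound for the total weight of the two arcs. -/
noncomputable def arcConst : ℝ := 2 * ∫ θ in (0 : ℝ)..(2 * Real.pi), (1 + arcWeight θ / 2)

theorem intervalIntegrable_one_add_arcWeight :
    IntervalIntegrable (fun θ => 1 + arcWeight θ / 2) volume 0 (2 * Real.pi) :=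
  intervalIntegrable_const.add (intervalIntegrable_arcWeight.div_const 2)

theorem arcConst_pos : 0 < arcConst := by
  refine mul_pos two_pos ?_
  refine intervalIntegral.intervalIntegral_pos_of_pos_on intervalIntegrable_one_add_arcWeight
    (fun θ hθ => ?_) Real.two_pi_pos
  have := arcWeight_pos hθ
  positivity

theorem norm_cassiniIntegral_le {w : ℂ} {r : ℝ} (hr : 0 < r) {ω : ℂ → ℂ → E} {B : ℝ} (hB : 0 ≤ B)
    (n : ℕ) (h : ∀ u ∈ lemniscate w r, ∀ v, ‖ω u v‖ ≤ B * (‖v‖ / ‖nodePoly w (n + 1) u‖)) :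
    ‖cassiniIntegral w r ω‖ ≤ B * arcConst / r ^ n := by
  have key : ∀ ε : ℝ, ε ^ 2 = 1 →
      ‖∫ θ in (0 : ℝ)..(2 * Real.pi), ω (cassiniArc w r ε θ) (deriv (cassiniArc w r ε) θ)‖ ≤
        B / r ^ n * ∫ θ in (0 : ℝ)..(2 * Real.pi), (1 + arcWeight θ / 2) := by
    intro ε hε
    rw [← intervalIntegral.integral_const_mul]
    refine intervalIntegral.norm_integral_le_of_norm_le Real.two_pi_pos.le ?_
      (intervalIntegrable_one_add_arcWeight.const_mul _)
    filter_upwards [ae_uIoc_Ioo] with θ h0 h1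
    rw [← uIoc_of_le Real.two_pi_pos.le] at h1
    refine (h _ (cassiniArc_mem w r hε θ) _).trans ?_
    rw [div_mul_eq_mul_div, mul_div_assoc]
    exact mul_le_mul_of_nonneg_left (norm_deriv_div_nodePoly_le w hr hε (h0 h1) n) hB
  unfold cassiniIntegral
  refine (norm_add_le_of_le (key 1 (by norm_num)) (key (-1) (by norm_num))).trans (le_of_eq ?_)
  rw [arcConst]; ring

end Forms

end SliceReg
namespace SliceReg

/-! ### Cauchy's theorem and formula on the lemniscate -/

section Cauchy

open MeasureTheory

/-- The even function `s ↦ (g(ξ + s) - g(ξ - s)) / (2s)`, extended by continuity to `s = 0`. -/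
noncomputable def oddQuot (g : ℂ → ℂ) (ξ s : ℂ) : ℂ :=
  (dslope (fun s => g (ξ + s)) 0 s + dslope (fun s => g (ξ + s)) 0 (-s)) / 2

theorem oddQuot_neg (g : ℂ → ℂ) (ξ s : ℂ) : oddQuot g ξ (-s) = oddQuot g ξ s := by
  simp [oddQuot, add_comm]

theorem oddQuot_of_ne (g : ℂ → ℂ) (ξ : ℂ) {s : ℂ} (hs : s ≠ 0) :
    oddQuot g ξ s = (g (ξ + s) - g (ξ - s)) / (2 * s) := by
  rw [oddQuot, dslope_of_ne _ hs, dslope_of_ne _ (neg_ne_zero.2 hs), slope_def_field,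
    slope_def_field]
  simp only [sub_zero, ← sub_eq_add_neg]
  field_simp
  ring

/-- The point `s` with `s² = T - η²` used by the arcs of the lemniscate. -/
noncomputable def arcRoot (η : ℝ) (T : ℂ) : ℂ :=
  Complex.I * ((η : ℂ) ^ 2 - T) ^ (1 / 2 : ℂ)

theorem cpow_half_sq (q : ℂ) : (q ^ (1 / 2 : ℂ)) ^ 2 = q := by simp

theorem arcRoot_sq (η : ℝ) (T : ℂ) : arcRoot η T ^ 2 = T - (η : ℂ) ^ 2 := by
  rw [arcRoot, mul_pow, cpow_half_sq, Complex.I_sq]; ring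

/-- Being even in s, the quotient depends only on s², hence only on T; the choice of the square root
is immaterial. -/
theorem oddQuot_eq_of_sq_eq (g : ℂ → ℂ) (ξ : ℂ) {s t : ℂ} (h : s ^ 2 = t ^ 2) :
    oddQuot g ξ s = oddQuot g ξ t := by
  rcases sq_eq_sq_iff_eq_or_eq_neg.1 h with rfl | rfl
  · rfl
  · exact oddQuot_neg _ _ _

theorem differentiableAt_oddQuot {g : ℂ → ℂ} {ξ s : ℂ} (h1 : DifferentiableAt ℂ g (ξ + s))
    (h2 : DifferentiableAt ℂ g (ξ - s)) (hs : s ≠ 0) : DifferentiableAt ℂ (oddQuot g ξ) s := by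
  have h1' : DifferentiableAt ℂ (fun s => g (ξ + s)) s :=
    DifferentiableAt.comp s h1 (by fun_prop)
  have h2' : DifferentiableAt ℂ (fun s => g (ξ + s)) (-s) :=
    DifferentiableAt.comp (-s) (by rwa [← sub_eq_add_neg]) (by fun_prop)
  have h3 := (differentiableAt_dslope_of_ne hs).2 h1'
  have h4 := (differentiableAt_dslope_of_ne (neg_ne_zero.2 hs)).2 h2'
  have h5 : DifferentiableAt ℂ (fun t => dslope (fun s => g (ξ + s)) 0 (-t)) s :=
    DifferentiableAt.comp s h4 (by fun_prop)
  exact (h3.add h5).div_const 2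

theorem continuousAt_oddQuot_zero {g : ℂ → ℂ} {ξ : ℂ} (h : DifferentiableAt ℂ g ξ) :
    ContinuousAt (oddQuot g ξ) 0 := by
  have h1 : DifferentiableAt ℂ (fun s => g (ξ + s)) 0 :=
    DifferentiableAt.comp 0 (by simpa using h) (by fun_prop)
  have h2 := continuousAt_dslope_same.2 h1
  have h3 : ContinuousAt (fun t => dslope (fun s => g (ξ + s)) 0 (-t)) 0 :=
    ContinuousAt.comp (by rw [neg_zero]; exact h2) (by fun_prop)
  exact (h2.add h3).div_const 2

theorem differentiableAt_oddQuot_arcRoot {g : ℂ → ℂ} {ξ : ℂ} {η : ℝ} {T : ℂ}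
    (h1 : ∀ s : ℂ, s ^ 2 = T - (η : ℂ) ^ 2 → DifferentiableAt ℂ g (ξ + s))
    (hT : T ≠ (η : ℂ) ^ 2) : DifferentiableAt ℂ (fun T => oddQuot g ξ (arcRoot η T)) T := by
  have key : ∀ b : ℂ → ℂ, (∀ T, b T ^ 2 = T - (η : ℂ) ^ 2) → DifferentiableAt ℂ b T →
      DifferentiableAt ℂ (fun T => oddQuot g ξ (arcRoot η T)) T := by
    intro b hb hd
    have e : (fun T => oddQuot g ξ (arcRoot η T)) = fun T => oddQuot g ξ (b T) := by
      funext T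
      exact oddQuot_eq_of_sq_eq g ξ (by rw [arcRoot_sq, hb])
    rw [e]
    refine DifferentiableAt.comp T (differentiableAt_oddQuot (h1 _ (hb T)) ?_ ?_) hd
    · rw [sub_eq_add_neg]; exact h1 _ (by rw [neg_sq, hb T])
    · intro h
      have := hb T
      rw [h, zero_pow two_ne_zero] at this
      exact hT (sub_eq_zero.1 this.symm)
  by_cases hs : (η : ℂ) ^ 2 - T ∈ Complex.slitPlane
  · refine key _ (arcRoot_sq η) ?_
    unfold arcRoot
    exact (DifferentiableAt.cpow_const (by fun_prop) hs).const_mul _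
  -- On the cut of the root of η² - T, the principal root of T - η² is a holomorphic branch and may
  -- replace it.
  · refine key (fun T => (T - (η : ℂ) ^ 2) ^ (1 / 2 : ℂ)) (fun T => cpow_half_sq _) ?_
    refine DifferentiableAt.cpow_const (by fun_prop) ?_
    rw [Complex.mem_slitPlane_iff] at hs ⊢
    push Not at hs
    left
    have h2 : T.re - ((η : ℂ) ^ 2).re ≠ 0 := by
      intro h0
      apply hT
      have := hs.2
      apply Complex.ext
      · linarith
      · simp only [Complex.sub_im] at this; linarith
    have := hs.1
    simp only [Complex.sub_re] at this ⊢
    exact lt_of_le_of_ne (by linarith) h2.symm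

/-- Only the branch value T = η² is new: there the principal root tends to 0 and the divided
difference tends to the derivative of g at ξ. -/
theorem continuousAt_oddQuot_arcRoot {g : ℂ → ℂ} {ξ : ℂ} {η : ℝ} {T : ℂ}
    (h1 : ∀ s : ℂ, s ^ 2 = T - (η : ℂ) ^ 2 → DifferentiableAt ℂ g (ξ + s)) :
    ContinuousAt (fun T => oddQuot g ξ (arcRoot η T)) T := by
  by_cases hT : T = (η : ℂ) ^ 2
  · have h0 : arcRoot η T = 0 := by simp [arcRoot, hT]
    have h2 : DifferentiableAt ℂ g ξ := by simpa using h1 0 (by simp [hT])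
    refine ContinuousAt.comp (f := arcRoot η) (by rw [h0]; exact continuousAt_oddQuot_zero h2) ?_
    unfold arcRoot
    refine continuousAt_const.mul ?_
    have h3 := Complex.continuousAt_cpow_zero_of_re_pos (z := (1 / 2 : ℂ)) (by norm_num)
    have h4 : ContinuousAt (fun T : ℂ => ((η : ℂ) ^ 2 - T, (1 / 2 : ℂ))) T := by fun_prop
    exact ContinuousAt.comp (f := fun T : ℂ => ((η : ℂ) ^ 2 - T, (1 / 2 : ℂ)))
      (by simpa [hT] using h3) h4
  · exact (differentiableAt_oddQuot_arcRoot h1 hT).continuousAt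

/-- Under T = Δ_w(ζ) the arcs are ξ ± s with dζ = ± dT/(2s), so the two integrands add up to the
divided difference of g. -/
theorem cassiniIntegral_eq_circleIntegral {w : ℂ} {r : ℝ} (hr : 0 < r) {g : ℂ → ℂ}
    (hg : ContinuousOn g (lemniscate w r)) :
    cassiniIntegral w r (fun u v => g u * v) =
      ∮ T in C(0, r ^ 2), oddQuot g w.re (arcRoot w.im T) := by
  have hreg := isRegularForm_mul hg
  rw [cassiniIntegral, circleIntegral, ← intervalIntegral.integral_add
    (hreg.intervalIntegrable hr (by norm_num)) (hreg.intervalIntegrable hr (by norm_num))]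
  refine intervalIntegral.integral_congr_ae ?_
  filter_upwards [ae_uIoc_Ioo] with θ h0 h1
  have hθ := h0 h1
  have e0 : circleMap 0 (r ^ 2) θ = (r : ℂ) ^ 2 * Complex.exp (θ * Complex.I) := by
    simp [circleMap]
  have hε : (-1 : ℝ) ^ 2 = 1 := by norm_num
  have e1 : cassiniArc w r 1 θ = w.re + arcRoot w.im (circleMap 0 (r ^ 2) θ) := by
    rw [e0, cassiniArc, arcRoot]; push_cast; ring
  have e2 : cassiniArc w r (-1) θ = w.re - arcRoot w.im (circleMap 0 (r ^ 2) θ) := by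
    rw [e0, cassiniArc, arcRoot]; push_cast; ring
  have hs := cassiniArc_sub_ne_zero w hr (one_pow 2) hθ
  rw [(hasDerivAt_cassiniArc w hr (one_pow 2) hθ).deriv, (hasDerivAt_cassiniArc w hr hε hθ).deriv,
    deriv_circleMap, smul_eq_mul, ← e0]
  rw [e1] at hs ⊢
  rw [e2]
  rw [add_sub_cancel_left] at hs
  rw [oddQuot_of_ne _ _ hs, add_sub_cancel_left, sub_sub_cancel_left]
  field_simp
  ring

theorem mem_of_sq_eq {w : ℂ} {r : ℝ} {T s : ℂ} (hT : T ∈ Metric.closedBall (0 : ℂ) (r ^ 2))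
    (hs : s ^ 2 = T - (w.im : ℂ) ^ 2) : ‖deltaC w (w.re + s)‖ ≤ r ^ 2 := by
  rw [deltaC_eq, add_sub_cancel_left, hs, sub_add_cancel]
  simpa using hT

theorem cassiniIntegral_eq_zero {w : ℂ} {r : ℝ} (hr : 0 < r) {D : Set ℂ} (hD : IsOpen D)
    (hsub : {u | ‖deltaC w u‖ ≤ r ^ 2} ⊆ D) {g : ℂ → ℂ} (hg : DifferentiableOn ℂ g D) :
    cassiniIntegral w r (fun u v => g u * v) = 0 := by
  have hd : ∀ T ∈ Metric.closedBall (0 : ℂ) (r ^ 2), ∀ s : ℂ, s ^ 2 = T - (w.im : ℂ) ^ 2 →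
      DifferentiableAt ℂ g (w.re + s) := fun T hT s hs =>
    hg.differentiableAt (hD.mem_nhds (hsub (mem_of_sq_eq hT hs)))
  rw [cassiniIntegral_eq_circleIntegral hr
    (hg.continuousOn.mono fun u hu => hsub (le_of_eq hu))]
  refine Complex.circleIntegral_eq_zero_of_differentiable_on_off_countable (sq_nonneg r)
    (s := {(w.im : ℂ) ^ 2}) (countable_singleton _) (fun T hT => ?_) fun T hT => ?_
  · exact (continuousAt_oddQuot_arcRoot (hd T hT)).continuousWithinAt
  · exact differentiableAt_oddQuot_arcRoot (hd T (Metric.ball_subset_closedBall hT.1)) hT.2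

/-- For g = 1/(ζ - z) the divided difference is 1/(T - Δ_w(z)). The winding number of the lemniscate
about z is thus that of the circle about Δ_w(z), whatever the shape of the lemniscate. -/
theorem cassiniIntegral_inv_sub {w z : ℂ} {r : ℝ} (hr : 0 < r) (hz : ‖deltaC w z‖ < r ^ 2) :
    cassiniIntegral w r (fun u v => (u - z)⁻¹ * v) = 2 * Real.pi * Complex.I := by
  have hne : ∀ u ∈ lemniscate w r, u - z ≠ 0 := by
    intro u hu h
    rw [sub_eq_zero.1 h] at hu
    exact hz.ne hu
  rw [cassiniIntegral_eq_circleIntegral (g := fun u => (u - z)⁻¹) hr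
    (ContinuousOn.inv₀ (by fun_prop) hne)]
  rw [← circleIntegral.integral_sub_inv_of_mem_ball (c := 0) (w := deltaC w z) (R := r ^ 2)
    (by simpa using hz)]
  rw [circleIntegral, circleIntegral]
  refine intervalIntegral.integral_congr_ae ?_
  filter_upwards [ae_uIoc_Ioo] with θ h0 h1
  have hθ := h0 h1
  have e0 : circleMap 0 (r ^ 2) θ = (r : ℂ) ^ 2 * Complex.exp (θ * Complex.I) := by
    simp [circleMap]
  have hε : (-1 : ℝ) ^ 2 = 1 := by norm_num
  have e1 : cassiniArc w r 1 θ = w.re + arcRoot w.im (circleMap 0 (r ^ 2) θ) := by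
    rw [e0, cassiniArc, arcRoot]; push_cast; ring
  have e2 : cassiniArc w r (-1) θ = w.re - arcRoot w.im (circleMap 0 (r ^ 2) θ) := by
    rw [e0, cassiniArc, arcRoot]; push_cast; ring
  have hs := cassiniArc_sub_ne_zero w hr (one_pow 2) hθ
  have n1 := hne _ (cassiniArc_mem w r (one_pow 2) θ)
  have n2 := hne _ (cassiniArc_mem w r hε θ)
  have hd : circleMap 0 (r ^ 2) θ - deltaC w z =
      (w.re + arcRoot w.im (circleMap 0 (r ^ 2) θ) - z) *
        -(w.re - arcRoot w.im (circleMap 0 (r ^ 2) θ) - z) := by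
    have := arcRoot_sq w.im (circleMap 0 (r ^ 2) θ)
    rw [deltaC_eq]
    linear_combination -this
  rw [e1] at hs n1
  rw [e2] at n2
  rw [add_sub_cancel_left] at hs
  rw [oddQuot_of_ne _ _ hs, hd]
  congr 1
  field_simp
  ring

/-- Split g(u) = (g(u) - g(z)) + g(z): the difference quotient extends holomorphically over z and
integrates to 0, and the constant gives the winding number. -/
theorem cassiniIntegral_cauchy {w z : ℂ} {r : ℝ} (hr : 0 < r) {D : Set ℂ} (hD : IsOpen D)
    (hsub : {u | ‖deltaC w u‖ ≤ r ^ 2} ⊆ D) {g : ℂ → ℂ} (hg : DifferentiableOn ℂ g D)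
    (hz : ‖deltaC w z‖ < r ^ 2) :
    cassiniIntegral w r (fun u v => (u - z)⁻¹ * g u * v) = 2 * Real.pi * Complex.I * g z := by
  have hzD : D ∈ 𝓝 z := hD.mem_nhds (hsub hz.le)
  have hne : ∀ u ∈ lemniscate w r, u ≠ z := by
    rintro u hu rfl
    exact hz.ne hu
  have h1 := (Complex.differentiableOn_dslope hzD).2 hg
  have hinv : ContinuousOn (fun u => (u - z)⁻¹) (lemniscate w r) :=
    ContinuousOn.inv₀ (by fun_prop) fun u hu => sub_ne_zero.2 (hne u hu)
  have r1 : IsRegularForm (lemniscate w r) fun u v => dslope g z u * v :=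
    isRegularForm_mul (h1.continuousOn.mono fun u hu => hsub (le_of_eq hu))
  have r2 : IsRegularForm (lemniscate w r) fun u v => (u - z)⁻¹ * v := isRegularForm_mul hinv
  let L : ℂ →L[ℝ] ℂ := (ContinuousLinearMap.mul ℝ ℂ) (g z)
  have r3 := r2.clm L
  have e : ∀ u ∈ lemniscate w r, ∀ v, (u - z)⁻¹ * g u * v =
      dslope g z u * v + L ((u - z)⁻¹ * v) := by
    intro u hu v
    have := sub_ne_zero.2 (hne u hu)
    change _ = _ + g z * _
    rw [dslope_of_ne _ (hne u hu), slope_def_field]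
    field_simp
    ring
  rw [cassiniIntegral_congr e, cassiniIntegral_add hr r1 r3, cassiniIntegral_clm hr r2,
    cassiniIntegral_eq_zero hr hD hsub h1, cassiniIntegral_inv_sub hr hz, zero_add]
  exact mul_comm _ _

end Cauchy

end SliceReg
namespace SliceReg

/-! ### The slices of the quadratic cone and the action of ℂ on A -/

section Cone

variable {A : Type*} [NormedNonAssocRing A] [NormedSpace ℝ A] [Nontrivial A]
    [IsScalarTower ℝ A A] [SMulCommClass ℝ A A] [FiniteDimensional ℝ A]
    [StarRing A] [StarModule ℝ A]

variable (A) in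
/-- The multiplication as a continuous bilinear map. -/
noncomputable def mulCLM : A →L[ℝ] A →L[ℝ] A :=
  LinearMap.toContinuousLinearMap
    ((LinearMap.toContinuousLinearMap : (A →ₗ[ℝ] A) ≃ₗ[ℝ] (A →L[ℝ] A)).toLinearMap ∘ₗ
      LinearMap.mul ℝ A)

@[simp] theorem mulCLM_apply (a b : A) : mulCLM A a b = a * b := rfl

/-- The norm need not be submultiplicative, and finite dimension supplies a constant. The summand 1
makes its positivity immediate. -/
theorem norm_mul_le' (a b : A) : ‖a * b‖ ≤ (‖mulCLM A‖ + 1) * ‖a‖ * ‖b‖ := by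
  rw [← mulCLM_apply]
  refine ((mulCLM A).le_opNorm₂ a b).trans ?_
  gcongr
  linarith

theorem _root_.ContinuousOn.alg_mul {X : Type*} [TopologicalSpace X] {s : Set X} {f g : X → A}
    (hf : ContinuousOn f s) (hg : ContinuousOn g s) : ContinuousOn (fun x => f x * g x) s :=
  ((mulCLM A).continuous.comp_continuousOn hf).clm_apply hg

theorem sphere_act (halt : IsAlternative A) {J : A} (hJ : J ∈ sphere A) (x : A) :
    J * (J * x) = -x := by
  rw [← halt.1, hJ.2, neg_one_mul]

/-- This is the only reassociation needed in the nonassociative case: left multiplication by the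
plane of `J` is an action of ℂ, because `J (J x) = (J J) x`. -/
theorem Phi_act (halt : IsAlternative A) {J : A} (hJ : J ∈ sphere A) (a b : ℂ) (x : A) :
    Phi J (a * b) * x = Phi J a * (Phi J b * x) := by
  simp only [Phi, add_mul, mul_add, smul_mul_assoc, mul_smul_comm, one_mul,
    sphere_act halt hJ, Complex.mul_re, Complex.mul_im]
  module

theorem Phi_add (J : A) (a b : ℂ) : Phi J (a + b) = Phi J a + Phi J b := by
  simp only [Phi, Complex.add_re, Complex.add_im, add_smul]; abel

theorem Phi_sub (J : A) (a b : ℂ) : Phi J (a - b) = Phi J a - Phi J b := by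
  simp only [Phi, Complex.sub_re, Complex.sub_im, sub_smul]; abel

theorem Phi_real_smul (J : A) (t : ℝ) (a : ℂ) : Phi J (t * a) = t • Phi J a := by
  simp [Phi, smul_smul]

@[simp] theorem Phi_zero (J : A) : Phi J 0 = 0 := by simp [Phi]
@[simp] theorem Phi_one (J : A) : Phi J 1 = 1 := by simp [Phi]
@[simp] theorem Phi_I (J : A) : Phi J Complex.I = J := by simp [Phi]
@[simp] theorem Phi_ofReal (J : A) (t : ℝ) : Phi J t = t • (1 : A) := by simp [Phi]

theorem continuous_Phi (J : A) : Continuous (Phi J) := by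
  unfold Phi
  exact (Complex.continuous_re.smul continuous_const).add
    (Complex.continuous_im.smul continuous_const)

theorem star_Phi {J : A} (hJ : J ∈ sphere A) (z : ℂ) : star (Phi J z) = Phi J (conj z) := by
  simp [Phi, star_sphere hJ]

theorem Phi_mem_quadraticCone {J : A} (hJ : J ∈ sphere A) (z : ℂ) :
    Phi J z ∈ quadraticCone A := by
  by_cases h : z.im = 0
  · left; exact ⟨z.re, by simp [Phi, h]⟩
  · right
    refine ⟨_, _, tr_Phi hJ z, sqn_Phi hJ z, ?_⟩
    have : 0 < z.im ^ 2 := by positivity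
    nlinarith

theorem norm_Phi (hN : NormOnCone A) {J : A} (hJ : J ∈ sphere A) (z : ℂ) : ‖Phi J z‖ = ‖z‖ := by
  have h := hN _ (Phi_mem_quadraticCone hJ z)
  rw [sqn_Phi hJ] at h
  have h2 := smul_left_injective ℝ (one_ne_zero (α := A)) h
  rw [← sq_eq_sq₀ (norm_nonneg _) (norm_nonneg _), ← h2, Complex.sq_norm, Complex.normSq_apply]
  ring

theorem norm_sphere (hN : NormOnCone A) {J : A} (hJ : J ∈ sphere A) : ‖J‖ = 1 := by
  have := norm_Phi hN hJ Complex.I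
  simpa using this

/-- For nonreal x with trace t and squared norm n, the element x - t/2 squares to -(n - t²/4) < 0,
and normalising it gives the imaginary unit. -/
theorem exists_eq_Phi {J : A} (hJ : J ∈ sphere A) {x : A} (hx : x ∈ quadraticCone A) :
    ∃ I ∈ sphere A, ∃ z : ℂ, x = Phi I z := by
  rcases hx with ⟨a, rfl⟩ | ⟨t, n, ht, hn, htn⟩
  -- A real point lies on every slice, and the given `J` serves as a unit.
  · exact ⟨J, hJ, a, by simp⟩
  · set b : ℝ := Real.sqrt (n - t ^ 2 / 4) with hb
    have hb0 : 0 < b := Real.sqrt_pos.2 (by linarith)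
    have hb2 : b * b = n - t ^ 2 / 4 := Real.mul_self_sqrt (by linarith)
    have hs : star x = t • (1 : A) - x := by rw [← ht]; simp [tr]
    have hxx : x * x = t • x - n • (1 : A) := by
      rw [sqn, hs, mul_sub, mul_smul_comm, mul_one] at hn
      rw [← hn]; abel
    set y : A := x - (t / 2) • (1 : A) with hy
    have hyy : y * y = -((b * b) • (1 : A)) := by
      rw [hy]
      simp only [sub_mul, mul_sub, smul_mul_assoc, mul_smul_comm, mul_one, one_mul, hxx, hb2]
      module
    have hsy : star y = -y := by
      rw [hy, star_sub, hs, star_smul, star_one, star_trivial]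
      module
    have hI : (b⁻¹ • y) * (b⁻¹ • y) = -1 := by
      rw [smul_mul_smul_comm, hyy, smul_neg, smul_smul]
      field_simp
      simp
    refine ⟨b⁻¹ • y, ⟨Or.inr ⟨0, 1, ?_, ?_, by norm_num⟩, hI⟩, ⟨t / 2, b⟩, ?_⟩
    · rw [tr, star_smul, hsy, star_trivial]; simp
    · rw [sqn, star_smul, hsy, star_trivial, smul_neg, mul_neg, hI]; simp
    · rw [Phi, smul_smul, mul_inv_cancel₀ hb0.ne', hy]; simp

theorem coneInv_Phi (hN : NormOnCone A) {J : A} (hJ : J ∈ sphere A) (z : ℂ) :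
    coneInv (Phi J z) = Phi J z⁻¹ := by
  rw [coneInv, star_Phi hJ, norm_Phi hN hJ, ← Phi_real_smul, Complex.inv_def, Complex.sq_norm,
    mul_comm]

/-- The trace determines the real part and the squared norm then determines the square of the
imaginary part. -/
theorem eq_or_eq_conj_of_Phi_eq {I J : A} (hI : I ∈ sphere A) (hJ : J ∈ sphere A) {u z : ℂ}
    (h : Phi I u = Phi J z) : u = z ∨ u = conj z := by
  have h1 := congrArg tr h
  have h2 := congrArg sqn h
  rw [tr_Phi hI, tr_Phi hJ] at h1
  rw [sqn_Phi hI, sqn_Phi hJ] at h2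
  have h1' := smul_left_injective ℝ (one_ne_zero (α := A)) h1
  have h2' := smul_left_injective ℝ (one_ne_zero (α := A)) h2
  have hre : u.re = z.re := by simpa using h1'
  simp only [hre, add_right_inj] at h2'
  rcases sq_eq_sq_iff_eq_or_eq_neg.1 h2' with h | h
  · exact Or.inl (Complex.ext hre h)
  · exact Or.inr (Complex.ext (by simp [hre]) (by simp [h]))

theorem mem_of_Phi_mem_circularSet {D : Set ℂ} (hD : ∀ z ∈ D, conj z ∈ D) {J : A}
    (hJ : J ∈ sphere A) {u : ℂ} (h : Phi J u ∈ circularSet D) : u ∈ D := by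
  obtain ⟨-, z, hz, I, hI, e⟩ := h
  rcases eq_or_eq_conj_of_Phi_eq hJ hI e with rfl | rfl
  · exact hz
  · exact hD z hz

theorem sphPoly_Phi_eq {J : A} (hJ : J ∈ sphere A) (w u : ℂ) (n : ℕ) :
    sphPoly (Phi J w) n (Phi J u) = Phi J (nodePoly w n u) := by
  rw [sphPoly, nodePoly, charPoly_Phi hJ hJ, Phi_pow hJ]
  split_ifs
  · rw [mul_one]
  · rw [Phi_mul hJ, Phi_sub]

theorem cassini_Phi (hN : NormOnCone A) {I J : A} (hI : I ∈ sphere A) (hJ : J ∈ sphere A)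
    (w z : ℂ) : cassini (Phi I z) (Phi J w) = Real.sqrt ‖deltaC w z‖ := by
  rw [cassini, charPoly_Phi hJ hI, norm_Phi hN hI]

theorem Phi_mem_cassiniBall (hN : NormOnCone A) {I J : A} (hI : I ∈ sphere A)
    (hJ : J ∈ sphere A) (w z : ℂ) (r : ℝ) :
    Phi I z ∈ cassiniBall (Phi J w) r ↔ z ∈ cassiniBallC w r := by
  change (_ ∧ cassini (Phi I z) (Phi J w) < r) ↔ Real.sqrt ‖deltaC w z‖ < r
  rw [cassini_Phi hN hI hJ]
  exact and_iff_right (Phi_mem_quadraticCone hI z)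

theorem cassiniBoundary_eq (hN : NormOnCone A) {J : A} (hJ : J ∈ sphere A) (w : ℂ) (r : ℝ) :
    cassiniBoundary J (Phi J w) r = Phi J '' frontier (cassiniBallC w r) := by
  have : {z : ℂ | Phi J z ∈ cassiniBall (Phi J w) r} = cassiniBallC w r := by
    ext z
    exact Phi_mem_cassiniBall hN hJ hJ w z r
  rw [cassiniBoundary, this]

theorem closedBall_subset (hN : NormOnCone A) {D : Set ℂ} (hD : ∀ z ∈ D, conj z ∈ D) {J : A}
    (hJ : J ∈ sphere A) {w : ℂ} {r : ℝ} (hr : 0 < r)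
    (hcl : closure (cassiniBall (Phi J w) r) ∩ quadraticCone A ⊆ circularSet D) :
    {u | ‖deltaC w u‖ ≤ r ^ 2} ⊆ D := by
  intro u hu
  refine mem_of_Phi_mem_circularSet hD hJ (hcl ⟨?_, Phi_mem_quadraticCone hJ u⟩)
  have h1 : u ∈ closure (cassiniBallC w r) := by
    rcases lt_or_eq_of_le (show ‖deltaC w u‖ ≤ r ^ 2 from hu) with h | h
    · exact subset_closure ((mem_cassiniBallC hr).2 h)
    · exact frontier_subset_closure (lemniscate_subset_frontier hr h)
  have h2 : Phi J '' cassiniBallC w r ⊆ cassiniBall (Phi J w) r := by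
    rintro _ ⟨z, hz, rfl⟩
    exact (Phi_mem_cassiniBall hN hJ hJ w z r).2 hz
  exact closure_mono h2 (image_closure_subset_closure_image (continuous_Phi J) ⟨u, h1, rfl⟩)

end Cone

/-! ### Calculus in the complexification -/

section Complexification

variable {A : Type*} [NormedNonAssocRing A] [NormedSpace ℝ A] [Nontrivial A]
    [IsScalarTower ℝ A A] [SMulCommClass ℝ A A] [FiniteDimensional ℝ A]
    [StarRing A] [StarModule ℝ A]

namespace Cx

/-- The value of `a + i b` under `i ↦ J`. -/
def ev (J : A) (q : Cx A) : A := q.re + J * q.im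

@[simp] theorem mul_re (p q : Cx A) : (p * q).re = p.re * q.re - p.im * q.im := rfl
@[simp] theorem mul_im (p q : Cx A) : (p * q).im = p.re * q.im + p.im * q.re := rfl
@[simp] theorem sub_re (p q : Cx A) : (p - q).re = p.re - q.re := rfl
@[simp] theorem sub_im (p q : Cx A) : (p - q).im = p.im - q.im := rfl
@[simp] theorem ofA_re (a : A) : (ofA a).re = a := rfl
@[simp] theorem ofA_im (a : A) : (ofA a).im = 0 := rfl
@[simp] theorem bar_re (q : Cx A) : q.bar.re = q.re := rfl
@[simp] theorem bar_im (q : Cx A) : q.bar.im = -q.im := rfl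
@[simp] theorem ofC_re (z : ℂ) : (ofC z : Cx A).re = z.re • (1 : A) := rfl
@[simp] theorem ofC_im (z : ℂ) : (ofC z : Cx A).im = z.im • (1 : A) := rfl

theorem bar_mul (p q : Cx A) : (p * q).bar = p.bar * q.bar := by
  ext <;> simp [add_comm]

theorem bar_sub (p q : Cx A) : (p - q).bar = p.bar - q.bar := by
  ext <;> simp [neg_add_eq_sub]

@[simp] theorem bar_ofA (a : A) : (ofA a).bar = ofA a := by
  ext <;> simp

theorem bar_ofC (z : ℂ) : (ofC z : Cx A).bar = ofC (conj z) := by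
  ext <;> simp

/-- The inclusion of `ℂ_J ⊗ ℂ`. -/
def ofPair (J : A) (a b : ℂ) : Cx A := ⟨Phi J a, Phi J b⟩

theorem ofC_eq (J : A) (z : ℂ) : (ofC z : Cx A) = ofPair J z.re z.im := by
  ext <;> simp [ofPair]

theorem ofA_Phi (J : A) (z : ℂ) : ofA (Phi J z) = ofPair J z 0 := by
  ext <;> simp [ofPair]

theorem ofPair_mul {J : A} (hJ : J ∈ sphere A) (a b c d : ℂ) :
    ofPair J a b * ofPair J c d = ofPair J (a * c - b * d) (a * d + b * c) := by
  ext <;> simp [ofPair, Phi_sub, Phi_add, Phi_mul hJ]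

theorem ofPair_sub (J : A) (a b c d : ℂ) :
    ofPair J a b - ofPair J c d = ofPair J (a - c) (b - d) := by
  ext <;> simp [ofPair, Phi_sub]

/-- The evaluation i ↦ `J` is not multiplicative on the whole complexification. It is when the left
factor comes from ℂ_J ⊗ ℂ, as do the stems of the spherical polynomials and the kernel of the
remainder. -/
theorem ev_ofPair_mul (halt : IsAlternative A) {J : A} (hJ : J ∈ sphere A) (a b : ℂ) (q : Cx A) :
    ev J (ofPair J a b * q) = Phi J (a + Complex.I * b) * ev J q := by
  have h1 : ∀ x, J * x = Phi J Complex.I * x := by simp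
  have h2 : ∀ x, -(Phi J b * x) = Phi J (Complex.I * b * Complex.I) * x := by
    intro x
    have : Complex.I * b * Complex.I = ((-1 : ℝ) : ℂ) * b := by
      push_cast; linear_combination b * Complex.I_mul_I
    rw [this, Phi_real_smul]; simp
  simp only [ev, mul_re, mul_im, ofPair, Phi_add, add_mul, mul_add, h1]
  simp only [← Phi_act halt hJ]
  rw [sub_eq_add_neg, h2, mul_comm a Complex.I]
  abel

end Cx

open Cx

/-- The representation formula: the value on the slice of `I` of a slice function in terms of
its values at `z` and `z̄` on the slice of `J`. -/
noncomputable def rep (I J : A) : A × A →ₗ[ℝ] A :=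
  (1 / 2 : ℝ) • (LinearMap.fst ℝ A A + LinearMap.snd ℝ A A -
    (LinearMap.mul ℝ A I) ∘ₗ (LinearMap.mul ℝ A J) ∘ₗ
      (LinearMap.fst ℝ A A - LinearMap.snd ℝ A A))

theorem rep_apply (I J a b : A) :
    rep I J (a, b) = (1 / 2 : ℝ) • (a + b - I * (J * (a - b))) := rfl

/-- The values of q and of its conjugate at i ↦ `J` determine both components of q. For a stem
function the second value is the one at z̄. -/
theorem ev_eq_rep (halt : IsAlternative A) (I : A) {J : A} (hJ : J ∈ sphere A) (q : Cx A) :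
    ev I q = rep I J (ev J q, ev J q.bar) := by
  rw [rep_apply]
  simp only [ev, bar_re, bar_im, mul_neg, mul_sub, mul_add, sphere_act halt hJ, neg_neg]
  module

theorem Cx.re_im_eq (halt : IsAlternative A) {J : A} (hJ : J ∈ sphere A) (q : Cx A) :
    q.re = (1 / 2 : ℝ) • (ev J q + ev J q.bar) ∧
      q.im = -((1 / 2 : ℝ) • (J * (ev J q - ev J q.bar))) := by
  simp only [ev, bar_re, bar_im, mul_neg, mul_sub, mul_add, sphere_act halt hJ, neg_neg]
  constructor <;> module

theorem norm_rep_le (hN : NormOnCone A) {I J : A} (hI : I ∈ sphere A) (hJ : J ∈ sphere A)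
    {a b : A} {B : ℝ} (ha : ‖a‖ ≤ B) (hb : ‖b‖ ≤ B) :
    ‖rep I J (a, b)‖ ≤ (1 + (‖mulCLM A‖ + 1) ^ 2) * B := by
  have h1 : ‖a + b‖ ≤ 2 * B := (norm_add_le _ _).trans (by linarith)
  have h2 : ‖a - b‖ ≤ 2 * B := (norm_sub_le _ _).trans (by linarith)
  have hK : 0 < ‖mulCLM A‖ + 1 := by positivity
  have h3 : ‖I * (J * (a - b))‖ ≤ (‖mulCLM A‖ + 1) * ((‖mulCLM A‖ + 1) * (2 * B)) := by
    refine (norm_mul_le' _ _).trans ?_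
    rw [norm_sphere hN hI, mul_one]
    gcongr
    refine (norm_mul_le' _ _).trans ?_
    rw [norm_sphere hN hJ, mul_one]
    gcongr
  rw [rep_apply, norm_smul, Real.norm_of_nonneg (by norm_num)]
  have := (norm_sub_le (a + b) (I * (J * (a - b))))
  nlinarith

theorem slice_Phi {D : Set ℂ} {F : ℂ → Cx A} (hF : IsStem D F) {z : ℂ} (hz : z ∈ D) {I : A}
    (hI : I ∈ sphere A) : slice F (Phi I z) = ev I (F z) := slice_apply hF hz hI

theorem IsStem.mul {D : Set ℂ} {F G : ℂ → Cx A} (hF : IsStem D F) (hG : IsStem D G) :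
    IsStem D fun z => F z * G z := fun z hz => by
  simp only [hF z hz, hG z hz, bar_mul]

theorem isStem_ofA (D : Set ℂ) (a : A) : IsStem D fun _ => ofA a := fun _ _ => by simp

theorem sphStem_Phi {J : A} (hJ : J ∈ sphere A) (w : ℂ) (n : ℕ) (z : ℂ) :
    sphStem (Phi J w) n z = if Even n then ofC (deltaC w z ^ (n / 2))
      else ofC (deltaC w z ^ (n / 2)) * (ofC z - ofA (Phi J w)) := by
  rw [sphStem, charStem_Phi hJ, ofC_pow]

theorem isStem_sphStem {J : A} (hJ : J ∈ sphere A) (D : Set ℂ) (w : ℂ) (n : ℕ) :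
    IsStem D (sphStem (Phi J w) n) := by
  intro z _
  rw [sphStem_Phi hJ, sphStem_Phi hJ, deltaC_conj, ← map_pow]
  split_ifs
  · rw [bar_ofC]
  · rw [bar_mul, bar_sub, bar_ofC, bar_ofC, bar_ofA]

theorem ev_sphStem_mul (halt : IsAlternative A) {J : A} (hJ : J ∈ sphere A) (w : ℂ) (n : ℕ)
    (z : ℂ) (q : Cx A) :
    ev J (sphStem (Phi J w) n z * q) = Phi J (nodePoly w n z) * ev J q := by
  rw [sphStem_Phi hJ, nodePoly]
  generalize deltaC w z ^ (n / 2) = c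
  split_ifs
  · rw [ofC_eq J, ev_ofPair_mul halt hJ, mul_comm Complex.I, Complex.re_add_im, mul_one]
  · rw [ofC_eq J, ofC_eq J, ofA_Phi, ofPair_sub, ofPair_mul hJ, ev_ofPair_mul halt hJ]
    congr 2
    have h1 := Complex.re_add_im c
    have h2 := Complex.re_add_im z
    simp only [sub_zero]
    linear_combination h1 * (z.re + z.im * Complex.I - w) + c * h2 -
      c.im * z.im * Complex.I_mul_I

theorem ev_ofA (J a : A) : ev J (ofA a) = a := by simp [ev]

theorem sphTerm_Phi (halt : IsAlternative A) {I J : A} (hI : I ∈ sphere A) (hJ : J ∈ sphere A)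
    (w : ℂ) (n : ℕ) (s : A) (z : ℂ) :
    sphTerm (Phi J w) n s (Phi I z) =
      rep I J (Phi J (nodePoly w n z) * s, Phi J (nodePoly w n (conj z)) * s) := by
  have hst := (isStem_sphStem hJ univ w n).mul (isStem_ofA univ s)
  rw [sphTerm, sliceMul, slice_Phi hst (mem_univ z) hI, ev_eq_rep halt I hJ,
    ← hst z (mem_univ z), ev_sphStem_mul halt hJ, ev_sphStem_mul halt hJ, ev_ofA]

end Complexification

end SliceReg
namespace SliceReg

/-! ### Holomorphic stem functions as holomorphic functions on one slice -/

section Holomorphy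

variable {A : Type*} [NormedNonAssocRing A] [NormedSpace ℝ A] [Nontrivial A]
    [IsScalarTower ℝ A A] [SMulCommClass ℝ A A] [FiniteDimensional ℝ A]
    [StarRing A] [StarModule ℝ A]

/-- For a real functional `φ`, the complex functional `a ↦ φ(a) - i φ(J a)` on `A` with the
complex structure of left multiplication by `J`. -/
noncomputable def testFun (J : A) (φ : A →L[ℝ] ℝ) : A →L[ℝ] ℂ :=
  Complex.ofRealCLM ∘L φ -
    (ContinuousLinearMap.mul ℝ ℂ Complex.I) ∘L Complex.ofRealCLM ∘L φ ∘L mulCLM A J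

theorem testFun_apply (J : A) (φ : A →L[ℝ] ℝ) (a : A) :
    testFun J φ a = φ a - Complex.I * φ (J * a) := rfl

theorem testFun_re (J : A) (φ : A →L[ℝ] ℝ) (a : A) : (testFun J φ a).re = φ a := by
  simp [testFun_apply]

theorem testFun_Phi (halt : IsAlternative A) {J : A} (hJ : J ∈ sphere A) (φ : A →L[ℝ] ℝ) (c : ℂ)
    (a : A) : testFun J φ (Phi J c * a) = c * testFun J φ a := by
  rw [Phi, add_mul, smul_mul_assoc, smul_mul_assoc, one_mul, map_add, map_smul, map_smul,
    testFun_apply, testFun_apply, sphere_act halt hJ, map_neg, Complex.real_smul,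
    Complex.real_smul]
  push_cast
  linear_combination Complex.re_add_im c * (φ a - Complex.I * φ (J * a)) +
    ((c.im : ℂ) * φ (J * a)) * Complex.I_mul_I

theorem testFun_J (halt : IsAlternative A) {J : A} (hJ : J ∈ sphere A) (φ : A →L[ℝ] ℝ)
    (a : A) : testFun J φ (J * a) = Complex.I * testFun J φ a := by
  rw [← testFun_Phi halt hJ, Phi_I]

theorem eq_of_forall_testFun {J a b : A} (h : ∀ φ : A →L[ℝ] ℝ, testFun J φ a = testFun J φ b) :
    a = b := by
  rw [← sub_eq_zero]
  refine SeparatingDual.eq_zero_of_forall_dual_eq_zero (R := ℝ) fun φ => ?_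
  rw [map_sub, ← testFun_re J, ← testFun_re J, h φ, sub_self]

/-- Holomorphy with respect to the complex structure of left multiplication by `J`. -/
def IsLeftHolo (J : A) (D : Set ℂ) (g : ℂ → A) : Prop :=
  ∀ φ : A →L[ℝ] ℝ, DifferentiableOn ℂ (fun z => testFun J φ (g z)) D

theorem IsHolo.differentiableAt {D : Set ℂ} (hD : IsOpen D) {F : ℂ → Cx A} (hF : IsHolo D F)
    {z : ℂ} (hz : z ∈ D) : DifferentiableAt ℝ (fun z => (F z).re) z ∧
      DifferentiableAt ℝ (fun z => (F z).im) z :=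
  ⟨(hF.1.differentiableOn one_ne_zero).differentiableAt (hD.mem_nhds hz),
    (hF.2.1.differentiableOn one_ne_zero).differentiableAt (hD.mem_nhds hz)⟩

/-- Cauchy–Riemann for (F₁, F₂) gives ∂_β(F₁ + JF₂) = J ∂_α(F₁ + JF₂), and `testFun J φ` turns `J`
into i. -/
theorem IsHolo.isLeftHolo (halt : IsAlternative A) {J : A} (hJ : J ∈ sphere A) {D : Set ℂ}
    (hD : IsOpen D) {F : ℂ → Cx A} (hF : IsHolo D F) : IsLeftHolo J D fun z => (F z).ev J := by
  intro φ z hz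
  apply DifferentiableAt.differentiableWithinAt
  obtain ⟨h1, h2⟩ := hF.differentiableAt hD hz
  obtain ⟨e1, e2⟩ := hF.2.2 z hz
  have h3 : HasFDerivAt (fun z => testFun J φ ((F z).ev J)) (testFun J φ ∘L
      (fderiv ℝ (fun z => (F z).re) z + mulCLM A J ∘L fderiv ℝ (fun z => (F z).im) z)) z :=
    (testFun J φ).hasFDerivAt.comp z
      (h1.hasFDerivAt.add ((mulCLM A J).hasFDerivAt.comp z h2.hasFDerivAt))
  rw [differentiableAt_complex_iff_differentiableAt_real]
  refine ⟨h3.differentiableAt, ?_⟩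
  rw [h3.fderiv]
  simp only [ContinuousLinearMap.comp_apply, add_apply, mulCLM_apply]
  rw [smul_eq_mul, ← testFun_J halt hJ, mul_add, sphere_act halt hJ, e1, e2, neg_neg,
    add_comm]

/-- Each real coordinate of g is the real part of a holomorphic function. -/
theorem IsLeftHolo.contDiffOn {J : A} {D : Set ℂ} (hD : IsOpen D) {g : ℂ → A}
    (hg : IsLeftHolo J D g) : ContDiffOn ℝ 1 g D := by
  let e := (Module.finBasis ℝ A).equivFunL
  have h : ContDiffOn ℝ 1 (fun z => e (g z)) D := by
    rw [contDiffOn_pi]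
    intro i
    let φ : A →L[ℝ] ℝ := ContinuousLinearMap.proj i ∘L (e : A →L[ℝ] (Fin (Module.finrank ℝ A) → ℝ))
    have h1 : ContDiffOn ℝ 1 (fun z => testFun J φ (g z)) D :=
      ((hg φ).contDiffOn hD).restrict_scalars ℝ
    have h2 : ContDiffOn ℝ 1 (fun z => (testFun J φ (g z)).re) D :=
      Complex.reCLM.contDiff.comp_contDiffOn h1
    exact h2.congr fun z _ => (testFun_re J φ (g z)).symm
  have h3 := (e.symm : (Fin (Module.finrank ℝ A) → ℝ) →L[ℝ] A).contDiff.comp_contDiffOn h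
  simpa [Function.comp_def] using h3

theorem IsLeftHolo.fderiv_I (halt : IsAlternative A) {J : A} (hJ : J ∈ sphere A) {D : Set ℂ}
    (hD : IsOpen D) {g : ℂ → A} (hg : IsLeftHolo J D g) {z : ℂ} (hz : z ∈ D) :
    DifferentiableAt ℝ g z ∧ fderiv ℝ g z Complex.I = J * fderiv ℝ g z 1 := by
  have h1 : DifferentiableAt ℝ g z :=
    ((hg.contDiffOn hD).differentiableOn one_ne_zero).differentiableAt (hD.mem_nhds hz)
  refine ⟨h1, eq_of_forall_testFun (J := J) fun φ => ?_⟩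
  have h2 := (hg φ).differentiableAt (hD.mem_nhds hz)
  have h3 := (differentiableAt_complex_iff_differentiableAt_real.1 h2).2
  have h4 : HasFDerivAt (fun z => testFun J φ (g z)) (testFun J φ ∘L fderiv ℝ g z) z :=
    (testFun J φ).hasFDerivAt.comp z h1.hasFDerivAt
  rw [h4.fderiv] at h3
  rw [testFun_J halt hJ]
  exact h3

/-- The stem symmetry expresses both components through g(z) and g(z̄), so regularity and the
Cauchy–Riemann equations on one slice determine those of the stem. -/
theorem IsLeftHolo.isHolo (halt : IsAlternative A) {J : A} (hJ : J ∈ sphere A) {D : Set ℂ}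
    (hD : IsOpen D) (hc : ∀ z ∈ D, conj z ∈ D) {R : ℂ → Cx A} (hR : IsStem D R)
    (hg : IsLeftHolo J D fun z => (R z).ev J) : IsHolo D R := by
  set g : ℂ → A := fun z => (R z).ev J with hgdef
  have e1 : ∀ z ∈ D, (R z).re = (1 / 2 : ℝ) • (g z + g (conj z)) := fun z hz => by
    rw [(Cx.re_im_eq halt hJ (R z)).1, ← hR z hz]
  have e2 : ∀ z ∈ D, (R z).im = -((1 / 2 : ℝ) • (J * (g z - g (conj z)))) := fun z hz => by
    rw [(Cx.re_im_eq halt hJ (R z)).2, ← hR z hz]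
  have c1 := hg.contDiffOn hD
  have c2 : ContDiffOn ℝ 1 (fun z => g (conj z)) D :=
    c1.comp Complex.conjCLE.contDiff.contDiffOn hc
  refine ⟨((c1.add c2).const_smul (1 / 2 : ℝ)).congr e1, ?_, fun z hz => ?_⟩
  · refine ContDiffOn.congr ?_ e2
    exact (((mulCLM A J).contDiff.comp_contDiffOn (c1.sub c2)).const_smul (1 / 2 : ℝ)).neg
  · obtain ⟨d1, i1⟩ := hg.fderiv_I halt hJ hD hz
    obtain ⟨d2, i2⟩ := hg.fderiv_I halt hJ hD (hc z hz)
    have h1 := d1.hasFDerivAt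
    have h2 : HasFDerivAt (fun z => g (conj z))
        (fderiv ℝ g (conj z) ∘L (Complex.conjCLE : ℂ →L[ℝ] ℂ)) z :=
      HasFDerivAt.comp z d2.hasFDerivAt Complex.conjCLE.hasFDerivAt
    have hz' := hD.mem_nhds hz
    have h3 : HasFDerivAt (fun z => (R z).re) _ z :=
      ((h1.add h2).const_smul (1 / 2 : ℝ)).congr_of_eventuallyEq
        (Filter.eventually_of_mem hz' e1)
    have h4 : HasFDerivAt (fun z => (R z).im) _ z :=
      (((mulCLM A J).hasFDerivAt.comp z (h1.sub h2)).const_smul (1 / 2 : ℝ)).neg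
        |>.congr_of_eventuallyEq (Filter.eventually_of_mem hz' e2)
    rw [h3.fderiv, h4.fderiv]
    simp [i1, i2, sphere_act halt hJ, sub_eq_add_neg, add_comm]

end Holomorphy

/-! ### Newton interpolation with Cauchy remainder on one slice -/

section Remainder

variable {A : Type*} [NormedNonAssocRing A] [NormedSpace ℝ A] [Nontrivial A]
    [IsScalarTower ℝ A A] [SMulCommClass ℝ A A] [FiniteDimensional ℝ A]
    [StarRing A] [StarModule ℝ A]

/-- The form `k(ζ) dζ g(ζ)` on the slice of `J`. -/
def actForm (J : A) (k : ℂ → ℂ) (g : ℂ → A) (u v : ℂ) : A := Phi J (k u * v) * g u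

theorem isRegularForm_actForm (J : A) {K : Set ℂ} {k : ℂ → ℂ} {g : ℂ → A} (hk : ContinuousOn k K)
    (hg : ContinuousOn g K) : IsRegularForm K (actForm J k g) := by
  refine ⟨fun u => Phi J (k u) * g u, fun u => Phi J (k u * Complex.I) * g u, ?_, ?_,
    fun u _ v => ?_⟩
  · exact ((continuous_Phi J).comp_continuousOn hk).alg_mul hg
  · exact ((continuous_Phi J).comp_continuousOn (hk.mul continuousOn_const)).alg_mul hg
  · rw [actForm, ← smul_mul_assoc, ← smul_mul_assoc, ← Phi_real_smul, ← Phi_real_smul, ← add_mul,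
      ← Phi_add]
    congr 2
    nth_rewrite 1 [← Complex.re_add_im v]
    ring

variable {J : A} {w : ℂ} {r : ℝ} {g : ℂ → A}

theorem Phi_mul_cassiniIntegral (halt : IsAlternative A) (hJ : J ∈ sphere A) (hr : 0 < r)
    {k : ℂ → ℂ} (hk : ContinuousOn k (lemniscate w r)) (hg : ContinuousOn g (lemniscate w r))
    (c : ℂ) : Phi J c * cassiniIntegral w r (actForm J k g) =
      cassiniIntegral w r (actForm J (fun u => c * k u) g) := by
  have : CompleteSpace A := FiniteDimensional.complete ℝ A
  have h := cassiniIntegral_clm hr (isRegularForm_actForm J hk hg) (mulCLM A (Phi J c))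
  rw [mulCLM_apply] at h
  rw [← h]
  refine cassiniIntegral_congr fun u _ v => ?_
  rw [mulCLM_apply, actForm, actForm, ← Phi_act halt hJ, mul_assoc]

theorem testFun_cassiniIntegral (halt : IsAlternative A) (hJ : J ∈ sphere A) (hr : 0 < r)
    {k : ℂ → ℂ} (hk : ContinuousOn k (lemniscate w r)) (hg : ContinuousOn g (lemniscate w r))
    (φ : A →L[ℝ] ℝ) : testFun J φ (cassiniIntegral w r (actForm J k g)) =
      cassiniIntegral w r (fun u v => k u * testFun J φ (g u) * v) := by
  have : CompleteSpace A := FiniteDimensional.complete ℝ A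
  rw [← cassiniIntegral_clm hr (isRegularForm_actForm J hk hg)]
  refine cassiniIntegral_congr fun u _ v => ?_
  rw [actForm, testFun_Phi halt hJ]; ring

/-- The coefficients `∫ p_{n+1}(ζ)⁻¹ dζ g(ζ)`. -/
noncomputable def coeffInt (J : A) (w : ℂ) (r : ℝ) (g : ℂ → A) (n : ℕ) : A :=
  cassiniIntegral w r (actForm J (fun u => (nodePoly w (n + 1) u)⁻¹) g)

/-- The remainders `∫ (ζ - z)⁻¹ p_n(ζ)⁻¹ dζ g(ζ)`. -/
noncomputable def remInt (J : A) (w : ℂ) (r : ℝ) (g : ℂ → A) (n : ℕ) (z : ℂ) : A :=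
  cassiniIntegral w r (actForm J (fun u => (u - z)⁻¹ * (nodePoly w n u)⁻¹) g)

theorem continuousOn_inv_nodePoly (w : ℂ) (hr : 0 < r) (n : ℕ) :
    ContinuousOn (fun u => (nodePoly w n u)⁻¹) (lemniscate w r) :=
  ContinuousOn.inv₀ (continuous_nodePoly w n).continuousOn fun _ hu =>
    nodePoly_ne_zero (deltaC_ne_zero_of_mem hr hu) n

theorem sub_ne_zero_of_mem {z u : ℂ} (hz : ‖deltaC w z‖ < r ^ 2) (hu : u ∈ lemniscate w r) :
    u - z ≠ 0 := by
  intro h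
  rw [sub_eq_zero.1 h] at hu
  exact hz.ne hu

theorem continuousOn_inv_sub {z : ℂ} (hz : ‖deltaC w z‖ < r ^ 2) :
    ContinuousOn (fun u => (u - z)⁻¹) (lemniscate w r) :=
  ContinuousOn.inv₀ (by fun_prop) fun _ hu => sub_ne_zero_of_mem hz hu

theorem continuousOn_remKernel (hr : 0 < r) {z : ℂ} (hz : ‖deltaC w z‖ < r ^ 2) (n : ℕ) :
    ContinuousOn (fun u => (u - z)⁻¹ * (nodePoly w n u)⁻¹) (lemniscate w r) :=
  (continuousOn_inv_sub hz).mul (continuousOn_inv_nodePoly w hr n)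

/-- One Newton step: 1/((ζ - z) p_n(ζ)) = 1/p_{n+1}(ζ) + (z - a_n)/((ζ - z) p_{n+1}(ζ)), the node
a_n being w for even n and w̄ for odd n. -/
theorem remInt_eq (halt : IsAlternative A) (hJ : J ∈ sphere A) (hr : 0 < r)
    (hg : ContinuousOn g (lemniscate w r)) {z : ℂ} (hz : ‖deltaC w z‖ < r ^ 2) (n : ℕ) :
    remInt J w r g n z = coeffInt J w r g n +
      Phi J (if Even n then z - w else z - conj w) * remInt J w r g (n + 1) z := by
  have r1 := isRegularForm_actForm J (continuousOn_inv_nodePoly w hr (n + 1)) hg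
  have r2 : IsRegularForm (lemniscate w r) (actForm J (fun u => (if Even n then z - w else
      z - conj w) * ((u - z)⁻¹ * (nodePoly w (n + 1) u)⁻¹)) g) :=
    isRegularForm_actForm J (continuousOn_const.mul (continuousOn_remKernel hr hz _)) hg
  rw [remInt, remInt, coeffInt, Phi_mul_cassiniIntegral halt hJ hr
    (continuousOn_remKernel hr hz _) hg, ← cassiniIntegral_add hr r1 r2]
  refine cassiniIntegral_congr fun u hu v => ?_
  rw [actForm, actForm, actForm, ← add_mul, ← Phi_add]
  congr 2
  have h1 := sub_ne_zero_of_mem hz hu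
  have h2 := nodePoly_ne_zero (deltaC_ne_zero_of_mem hr hu) n
  have h3 := nodePoly_ne_zero (deltaC_ne_zero_of_mem hr hu) (n + 1)
  rw [nodePoly_succ'] at h3 ⊢
  have h4 := right_ne_zero_of_mul h3
  split_ifs at h4 ⊢
  all_goals
    field_simp
    ring

theorem remInt_zero (halt : IsAlternative A) (hJ : J ∈ sphere A) (hr : 0 < r) {D : Set ℂ}
    (hD : IsOpen D) (hsub : {u | ‖deltaC w u‖ ≤ r ^ 2} ⊆ D) (hg : IsLeftHolo J D g) {z : ℂ}
    (hz : ‖deltaC w z‖ < r ^ 2) :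
    remInt J w r g 0 z = Phi J (2 * Real.pi * Complex.I) * g z := by
  have hgc : ContinuousOn g (lemniscate w r) :=
    (hg.contDiffOn hD).continuousOn.mono fun u hu => hsub (le_of_eq hu)
  refine eq_of_forall_testFun (J := J) fun φ => ?_
  rw [testFun_Phi halt hJ, ← cassiniIntegral_cauchy hr hD hsub (hg φ) hz, remInt,
    testFun_cassiniIntegral halt hJ hr (continuousOn_remKernel hr hz 0) hgc]
  simp only [nodePoly_zero, inv_one, mul_one]

theorem expansion_remInt (halt : IsAlternative A) (hJ : J ∈ sphere A) (hr : 0 < r) {D : Set ℂ}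
    (hD : IsOpen D) (hsub : {u | ‖deltaC w u‖ ≤ r ^ 2} ⊆ D) (hg : IsLeftHolo J D g) {z : ℂ}
    (hz : ‖deltaC w z‖ < r ^ 2) (n : ℕ) :
    Phi J (2 * Real.pi * Complex.I) * g z =
      ∑ k ∈ Finset.range n, Phi J (nodePoly w k z) * coeffInt J w r g k +
        Phi J (nodePoly w n z) * remInt J w r g n z := by
  have hgc : ContinuousOn g (lemniscate w r) :=
    (hg.contDiffOn hD).continuousOn.mono fun u hu => hsub (le_of_eq hu)
  induction n with
  | zero => simp [nodePoly_zero, remInt_zero halt hJ hr hD hsub hg hz]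
  | succ n ih =>
    rw [ih, remInt_eq halt hJ hr hgc hz n, Finset.sum_range_succ, mul_add, ← Phi_act halt hJ,
      nodePoly_succ', add_assoc]

theorem sub_sum_eq_remInt (halt : IsAlternative A) (hJ : J ∈ sphere A) (hr : 0 < r) {D : Set ℂ}
    (hD : IsOpen D) (hsub : {u | ‖deltaC w u‖ ≤ r ^ 2} ⊆ D) (hg : IsLeftHolo J D g) {z : ℂ}
    (hz : ‖deltaC w z‖ < r ^ 2) (n : ℕ) :
    g z - ∑ k ∈ Finset.range n, Phi J (nodePoly w k z) *
        (Phi J (2 * Real.pi * Complex.I)⁻¹ * coeffInt J w r g k) =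
      Phi J (nodePoly w n z) * (Phi J (2 * Real.pi * Complex.I)⁻¹ * remInt J w r g n z) := by
  have h := congrArg (fun a => Phi J (2 * Real.pi * Complex.I)⁻¹ * a)
    (expansion_remInt halt hJ hr hD hsub hg hz n)
  simp only [mul_add, Finset.mul_sum, ← Phi_act halt hJ] at h ⊢
  have h0 : (2 * Real.pi * Complex.I)⁻¹ * (2 * Real.pi * Complex.I) = 1 :=
    inv_mul_cancel₀ (by simp [Real.pi_ne_zero])
  rw [h0, Phi_one, one_mul] at h
  simp only [mul_comm (2 * (Real.pi : ℂ) * Complex.I)⁻¹] at h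
  rw [h, add_sub_cancel_left]

end Remainder

end SliceReg
namespace SliceReg

/-! ### Holomorphy of Cauchy type integrals -/

section CauchyType

open MeasureTheory

theorem differentiableAt_cauchyIntegral {w : ℂ} {r : ℝ} (hr : 0 < r) {k : ℂ → ℂ}
    (hk : ContinuousOn k (lemniscate w r)) {z : ℂ} (hz : z ∉ lemniscate w r) :
    DifferentiableAt ℂ (fun z => cassiniIntegral w r fun u v => (u - z)⁻¹ * k u * v) z := by
  obtain ⟨δ', hδ', hball⟩ := Metric.mem_nhds_iff.1
    ((isCompact_lemniscate w r).isClosed.isOpen_compl.mem_nhds hz)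
  -- Half the radius is kept in reserve: every point within δ of z stays at distance at least δ from
  -- the lemniscate, which bounds the differentiated kernel by δ⁻².
  obtain ⟨δ, hδ, rfl⟩ : ∃ δ > 0, δ' = δ + δ := ⟨δ' / 2, by positivity, by ring⟩
  have hdist : ∀ u ∈ lemniscate w r, ∀ z' ∈ Metric.ball z δ, δ ≤ ‖u - z'‖ := by
    intro u hu z' hz'
    by_contra! h
    refine absurd hu (hball ?_)
    rw [mem_ball_iff_norm] at hz' ⊢
    calc ‖u - z‖ = ‖(u - z') + (z' - z)‖ := by ring_nf
      _ ≤ ‖u - z'‖ + ‖z' - z‖ := norm_add_le _ _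
      _ < δ + δ := add_lt_add h hz'
  have hne : ∀ u ∈ lemniscate w r, ∀ z' ∈ Metric.ball z δ, u - z' ≠ 0 := fun u hu z' hz' =>
    norm_pos_iff.1 (hδ.trans_le (hdist u hu z' hz'))
  have hreg : ∀ z' ∈ Metric.ball z δ, ∀ m : ℕ,
      IsRegularForm (lemniscate w r) fun u v => ((u - z') ^ m)⁻¹ * k u * v := fun z' hz' m =>
    isRegularForm_mul ((ContinuousOn.inv₀ (by fun_prop) fun u hu =>
      pow_ne_zero m (hne u hu z' hz')).mul hk)
  have hzb := Metric.mem_ball_self (x := z) hδ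
  have key : ∀ ε : ℝ, ε ^ 2 = 1 → DifferentiableAt ℂ (fun z => ∫ θ in (0 : ℝ)..(2 * Real.pi),
      (cassiniArc w r ε θ - z)⁻¹ * k (cassiniArc w r ε θ) * deriv (cassiniArc w r ε) θ) z := by
    intro ε hε
    refine (intervalIntegral.hasDerivAt_integral_of_dominated_loc_of_deriv_le
      (F := fun z θ => (cassiniArc w r ε θ - z)⁻¹ * k (cassiniArc w r ε θ) *
        deriv (cassiniArc w r ε) θ)
      (F' := fun z θ => ((cassiniArc w r ε θ - z) ^ 2)⁻¹ * k (cassiniArc w r ε θ) *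
        deriv (cassiniArc w r ε) θ)
      (bound := fun θ => (δ ^ 2)⁻¹ * ‖k (cassiniArc w r ε θ) * deriv (cassiniArc w r ε) θ‖)
      (Metric.ball_mem_nhds z hδ) ?_ ?_ ?_ ?_ ?_ ?_).2.differentiableAt
    · filter_upwards [Metric.ball_mem_nhds z hδ] with z' hz'
      have := (hreg z' hz' 1).intervalIntegrable hr hε
      simp only [pow_one] at this
      exact this.def'.aestronglyMeasurable
    · have := (hreg z hzb 1).intervalIntegrable hr hε
      simpa only [pow_one] using this
    · exact ((hreg z hzb 2).intervalIntegrable hr hε).def'.aestronglyMeasurable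
    · refine Eventually.of_forall fun θ _ z' hz' => ?_
      have h1 := hdist _ (cassiniArc_mem w r hε θ) z' hz'
      rw [mul_assoc, norm_mul, norm_inv, norm_pow]
      gcongr
    · exact (((isRegularForm_mul hk).intervalIntegrable hr hε).norm).const_mul _
    · refine Eventually.of_forall fun θ _ z' hz' => ?_
      have h1 := hne _ (cassiniArc_mem w r hε θ) z' hz'
      have h2 : HasDerivAt (fun x => cassiniArc w r ε θ - x) (-1) z' :=
        (hasDerivAt_id z').const_sub _
      have h3 := ((h2.fun_inv h1).mul_const (k (cassiniArc w r ε θ))).mul_const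
        (deriv (cassiniArc w r ε) θ)
      refine h3.congr_deriv ?_
      rw [neg_neg, one_div]
  exact (key 1 (by norm_num)).add (key (-1) (by norm_num))

end CauchyType

/-! ### The stem function of the remainder -/

section RemainderStem

open Cx

variable {A : Type*} [NormedNonAssocRing A] [NormedSpace ℝ A] [Nontrivial A]
    [IsScalarTower ℝ A A] [SMulCommClass ℝ A A] [FiniteDimensional ℝ A]
    [StarRing A] [StarModule ℝ A]

variable {J : A} {w : ℂ} {r : ℝ} {g : ℂ → A}

theorem isLeftHolo_remInt (halt : IsAlternative A) (hJ : J ∈ sphere A) (hr : 0 < r)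
    (hg : ContinuousOn g (lemniscate w r)) (n : ℕ) :
    IsLeftHolo J (cassiniBallC w r) (remInt J w r g n) := by
  intro φ
  have hk : ContinuousOn (fun u => (nodePoly w n u)⁻¹ * testFun J φ (g u)) (lemniscate w r) :=
    (continuousOn_inv_nodePoly w hr n).mul ((testFun J φ).continuous.comp_continuousOn hg)
  refine DifferentiableOn.congr (f := fun z => cassiniIntegral w r fun u v =>
    (u - z)⁻¹ * ((nodePoly w n u)⁻¹ * testFun J φ (g u)) * v) (fun z hz => ?_) fun z hz => ?_
  · rw [mem_cassiniBallC hr] at hz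
    exact (differentiableAt_cauchyIntegral hr hk fun h => hz.ne h).differentiableWithinAt
  · rw [mem_cassiniBallC hr] at hz
    rw [remInt, testFun_cassiniIntegral halt hJ hr (continuousOn_remKernel hr hz n) hg]
    simp only [mul_assoc]

theorem deltaC_ne_zero {z u : ℂ} (hz : ‖deltaC w z‖ < r ^ 2) (hu : u ∈ lemniscate w r) :
    deltaC u z ≠ 0 := by
  refine mul_ne_zero ?_ ?_
  · rw [← neg_sub]; exact neg_ne_zero.2 (sub_ne_zero_of_mem hz hu)
  · intro h
    rw [sub_eq_zero] at h
    rw [h, deltaC_conj, RCLike.norm_conj] at hz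
    exact hz.ne hu

/-- The coefficient of the real part of the kernel of the remainder. -/
noncomputable def stemKernelRe (w : ℂ) (n : ℕ) (z u : ℂ) : ℂ :=
  (((deltaC u z)⁻¹.re : ℂ) * (conj u - z.re) + (deltaC u z)⁻¹.im * z.im) *
    (Complex.I⁻¹ * (nodePoly w (n + 1) u)⁻¹)

/-- The coefficient of the imaginary part of the kernel of the remainder. -/
noncomputable def stemKernelIm (w : ℂ) (n : ℕ) (z u : ℂ) : ℂ :=
  (((deltaC u z)⁻¹.im : ℂ) * (conj u - z.re) - (deltaC u z)⁻¹.re * z.im) *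
    (Complex.I⁻¹ * (nodePoly w (n + 1) u)⁻¹)

/-- On the slice of `J` the kernel Δ_u(z)⁻¹(ū - z) collapses to the Cauchy kernel 1/(u - z), since
Δ_u(z) = (z - u)(z - ū). -/
theorem stemKernel_add {z u : ℂ} (hz : ‖deltaC w z‖ < r ^ 2) (hu : u ∈ lemniscate w r) (n : ℕ) :
    stemKernelRe w n z u + Complex.I * stemKernelIm w n z u =
      Complex.I⁻¹ * ((u - z)⁻¹ * (nodePoly w (n + 1) u)⁻¹) := by
  have h0 := deltaC_ne_zero hz hu
  have h1 : (deltaC u z)⁻¹ * (conj u - z) = (u - z)⁻¹ := by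
    have h2 : z - conj u ≠ 0 := right_ne_zero_of_mul h0
    have h3 := sub_ne_zero_of_mem hz hu
    have h4 : z - u ≠ 0 := left_ne_zero_of_mul h0
    rw [deltaC]
    field_simp
    ring
  rw [stemKernelRe, stemKernelIm, ← mul_assoc Complex.I⁻¹, mul_comm Complex.I⁻¹ (u - z)⁻¹,
    mul_assoc (u - z)⁻¹, ← mul_assoc Complex.I, ← add_mul, ← h1]
  congr 1
  generalize (deltaC u z)⁻¹ = c
  linear_combination Complex.re_add_im c * (conj u - z.re - z.im * Complex.I) -
    c * Complex.re_add_im z + (c.im * z.im : ℂ) * Complex.I_mul_I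

theorem continuousOn_stemKernel (hr : 0 < r) {z : ℂ} (hz : ‖deltaC w z‖ < r ^ 2) (n : ℕ) :
    ContinuousOn (stemKernelRe w n z) (lemniscate w r) ∧
      ContinuousOn (stemKernelIm w n z) (lemniscate w r) := by
  have h1 : ContinuousOn (fun u => (deltaC u z)⁻¹) (lemniscate w r) := by
    refine ContinuousOn.inv₀ ?_ fun u hu => deltaC_ne_zero hz hu
    unfold deltaC
    fun_prop
  have h2 : ContinuousOn (fun u => ((deltaC u z)⁻¹.re : ℂ)) (lemniscate w r) :=
    (Complex.continuous_ofReal.comp Complex.continuous_re).comp_continuousOn h1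
  have h3 : ContinuousOn (fun u => ((deltaC u z)⁻¹.im : ℂ)) (lemniscate w r) :=
    (Complex.continuous_ofReal.comp Complex.continuous_im).comp_continuousOn h1
  have h4 : ContinuousOn (fun u => Complex.I⁻¹ * (nodePoly w (n + 1) u)⁻¹) (lemniscate w r) :=
    continuousOn_const.mul (continuousOn_inv_nodePoly w hr _)
  have h5 : ContinuousOn (fun u => conj u - (z.re : ℂ)) (lemniscate w r) := by fun_prop
  exact ⟨((h2.mul h5).add (h3.mul continuousOn_const)).mul h4,
    ((h3.mul h5).sub (h2.mul continuousOn_const)).mul h4⟩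

theorem remForm_eq (hN : NormOnCone A) (hJ : J ∈ sphere A) (f : A → A) (n : ℕ) (z u v : ℂ) :
    remForm J (Phi J w) f n z u v =
      ofPair J (stemKernelRe w n z u * v) (stemKernelIm w n z u * v) * ofA (f (Phi J u)) := by
  have h : coneInv J = Phi J Complex.I⁻¹ := by
    rw [← coneInv_Phi hN hJ, Phi_I]
  rw [remForm, sphPoly_Phi_eq hJ, coneInv_Phi hN hJ, h, star_Phi hJ]
  simp only [ofC_eq J, ofA_Phi, ofPair_sub, ofPair_mul hJ]
  congr 2
  · rw [stemKernelRe]; ring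
  · rw [stemKernelIm]; ring

theorem remForm_re_im (hN : NormOnCone A) (hJ : J ∈ sphere A) (f : A → A) (n : ℕ) (z u v : ℂ) :
    (remForm J (Phi J w) f n z u v).re =
        actForm J (stemKernelRe w n z) (fun u => f (Phi J u)) u v ∧
      (remForm J (Phi J w) f n z u v).im =
        actForm J (stemKernelIm w n z) (fun u => f (Phi J u)) u v := by
  rw [remForm_eq hN hJ]
  constructor <;> simp [actForm, ofPair]

/-- The symmetry already holds for the integrand: conjugation of the complexification is
multiplicative, fixes the factors from `A`, and sends those in z to the same ones in z̄. -/
theorem isStem_remStem (D : Set ℂ) (y : A) (f : A → A) (n : ℕ) :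
    IsStem D (remStem J y w r f n) := by
  intro z _
  have h : ∀ u v, remForm J y f n (conj z) u v = (remForm J y f n z u v).bar := fun u v => by
    simp only [remForm, bar_mul, bar_sub, bar_ofA, bar_ofC, deltaC_conj, map_inv₀]
  simp only [remStem, h, cassiniIntegral_neg, bar]

theorem ev_remStem (halt : IsAlternative A) (hN : NormOnCone A) (hJ : J ∈ sphere A) (hr : 0 < r)
    {f : A → A} (hf : ContinuousOn (fun u => f (Phi J u)) (lemniscate w r)) (n : ℕ) {z : ℂ}
    (hz : ‖deltaC w z‖ < r ^ 2) :
    ev J (remStem J (Phi J w) w r f n z) =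
      Phi J Complex.I⁻¹ * remInt J w r (fun u => f (Phi J u)) (n + 1) z := by
  obtain ⟨c1, c2⟩ := continuousOn_stemKernel hr hz n
  have hI : ∀ a : A, J * a = Phi J Complex.I * a := fun a => by rw [Phi_I]
  rw [ev, remStem, remInt, Phi_mul_cassiniIntegral halt hJ hr (continuousOn_remKernel hr hz _) hf]
  simp only [(remForm_re_im hN hJ f n z _ _).1, (remForm_re_im hN hJ f n z _ _).2]
  have r1 := isRegularForm_actForm J c1 hf
  have r2 : IsRegularForm (lemniscate w r) (actForm J (fun u => Complex.I * stemKernelIm w n z u)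
      fun u => f (Phi J u)) := isRegularForm_actForm J (continuousOn_const.mul c2) hf
  rw [hI, Phi_mul_cassiniIntegral halt hJ hr c2 hf, ← cassiniIntegral_add hr r1 r2]
  refine cassiniIntegral_congr fun u hu v => ?_
  rw [actForm, actForm, actForm, ← add_mul, ← Phi_add, ← add_mul, stemKernel_add hz hu]

theorem IsLeftHolo.Phi_mul (halt : IsAlternative A) (hJ : J ∈ sphere A) {D : Set ℂ}
    (hg : IsLeftHolo J D g) (c : ℂ) : IsLeftHolo J D fun z => Phi J c * g z := fun φ => by
  simp only [testFun_Phi halt hJ]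
  exact (hg φ).const_mul c

theorem IsLeftHolo.congr {D : Set ℂ} {g' : ℂ → A} (hg : IsLeftHolo J D g)
    (h : ∀ z ∈ D, g' z = g z) : IsLeftHolo J D g' := fun φ =>
  (hg φ).congr fun z hz => by rw [h z hz]

theorem isHolo_remStem (halt : IsAlternative A) (hN : NormOnCone A) (hJ : J ∈ sphere A)
    (hr : 0 < r) {f : A → A} (hf : ContinuousOn (fun u => f (Phi J u)) (lemniscate w r)) (n : ℕ) :
    IsHolo (cassiniBallC w r) (remStem J (Phi J w) w r f n) :=
  IsLeftHolo.isHolo halt hJ (isOpen_cassiniBallC w r) (fun _ => conj_mem_cassiniBallC)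
    (isStem_remStem _ _ f n) <|
    ((isLeftHolo_remInt halt hJ hr hf (n + 1)).Phi_mul halt hJ Complex.I⁻¹).congr fun _ hz =>
      ev_remStem halt hN hJ hr hf n ((mem_cassiniBallC hr).1 hz)

theorem slice_remStem_of_assoc (hN : NormOnCone A) (hJ : J ∈ sphere A)
    (hr : 0 < r) {f : A → A} (hf : ContinuousOn (fun u => f (Phi J u)) (lemniscate w r)) (n : ℕ)
    (hassoc : ∀ a b c : A, a * b * c = a * (b * c)) {I : A} (hI : I ∈ sphere A) {z : ℂ}
    (hz : ‖deltaC w z‖ < r ^ 2) :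
    slice (remStem J (Phi J w) w r f n) (Phi I z) =
      cassiniIntegral w r (remFormAssoc J (Phi J w) f n (Phi I z)) := by
  have : CompleteSpace A := FiniteDimensional.complete ℝ A
  obtain ⟨c1, c2⟩ := continuousOn_stemKernel hr hz n
  have r1 := isRegularForm_actForm J c1 hf
  have r2 := isRegularForm_actForm J c2 hf
  rw [slice_Phi (isStem_remStem univ _ f n) (mem_univ z) hI, ev, remStem]
  simp only [(remForm_re_im hN hJ f n z _ _).1, (remForm_re_im hN hJ f n z _ _).2]
  have h := cassiniIntegral_clm hr r2 (mulCLM A I)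
  rw [mulCLM_apply] at h
  rw [← h, ← cassiniIntegral_add hr r1 (r2.clm _)]
  refine cassiniIntegral_congr fun u _ v => ?_
  rw [mulCLM_apply, ← (remForm_re_im hN hJ f n z u v).1, ← (remForm_re_im hN hJ f n z u v).2]
  rw [remForm, remFormAssoc, charPoly_Phi hJ hI, coneInv_Phi hN hI]
  generalize (deltaC u z)⁻¹ = c
  -- Associativity enters here: evaluation commutes with right multiplication by `A`, so the four
  -- right factors come out and only the part in z is evaluated.
  have e : ∀ p : Cx A, ∀ a : A, ev I (p * ofA a) = ev I p * a := by
    intro p a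
    simp [ev, add_mul, hassoc]
  change ev I _ = _
  rw [e, e, e, e]
  congr 4
  simp only [ev, mul_re, mul_im, sub_re, sub_im, ofC_re, ofC_im, ofA_re, ofA_im, mul_sub,
    smul_mul_assoc, mul_smul_comm, one_mul, mul_one, Phi, mul_add, add_mul, zero_sub, smul_neg,
    mul_neg, hI.2]
  module

end RemainderStem

end SliceReg
namespace SliceReg

/-! ### Bounds for coefficients, remainders and node polynomials -/

section Estimates

variable {A : Type*} [NormedNonAssocRing A] [NormedSpace ℝ A] [Nontrivial A]
    [IsScalarTower ℝ A A] [SMulCommClass ℝ A A] [FiniteDimensional ℝ A]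
    [StarRing A] [StarModule ℝ A]

variable {J : A} {w : ℂ} {r : ℝ} {g : ℂ → A}

theorem norm_Phi_mul_le (hN : NormOnCone A) (hJ : J ∈ sphere A) (c : ℂ) (a : A) :
    ‖Phi J c * a‖ ≤ (‖mulCLM A‖ + 1) * ‖c‖ * ‖a‖ := by
  refine (norm_mul_le' _ _).trans (le_of_eq ?_)
  rw [norm_Phi hN hJ]

theorem norm_coeffInt_le (hN : NormOnCone A) (hJ : J ∈ sphere A) (hr : 0 < r) {S : ℝ}
    (hS0 : 0 ≤ S) (hS : ∀ u ∈ lemniscate w r, ‖g u‖ ≤ S) (n : ℕ) :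
    ‖coeffInt J w r g n‖ ≤ (‖mulCLM A‖ + 1) * S * arcConst / r ^ n := by
  refine norm_cassiniIntegral_le hr (by positivity) n fun u hu v => ?_
  refine (norm_Phi_mul_le hN hJ _ _).trans ?_
  rw [norm_mul, norm_inv]
  calc (‖mulCLM A‖ + 1) * (‖nodePoly w (n + 1) u‖⁻¹ * ‖v‖) * ‖g u‖
      ≤ (‖mulCLM A‖ + 1) * (‖nodePoly w (n + 1) u‖⁻¹ * ‖v‖) * S := by
        gcongr; exact hS u hu
    _ = _ := by rw [div_eq_inv_mul]; ring

/-- From Δ_w(u) - Δ_w(z) = (u - z)(u + z - 2ξ): the left side has modulus at least r² - t² ≥ r(r -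
t), and the second factor is at most 2(r + 2|η|). -/
theorem norm_inv_sub_le (hr : 0 < r) {t : ℝ} (ht0 : 0 ≤ t) (htr : t < r) {u z : ℂ}
    (hu : u ∈ lemniscate w r) (hz : ‖deltaC w z‖ = t ^ 2) :
    ‖(u - z)⁻¹‖ ≤ 2 * (r + 2 * |w.im|) / (r * (r - t)) := by
  have hu' : ‖deltaC w u‖ = r ^ 2 := hu
  have h1 : deltaC w u - deltaC w z = (u - z) * ((u - w.re) + (z - w.re)) := by
    rw [deltaC_eq, deltaC_eq]; ring
  have h2 : r ^ 2 - t ^ 2 ≤ ‖deltaC w u - deltaC w z‖ := by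
    rw [← hu', ← hz]; exact norm_sub_norm_le _ _
  have h3 : ‖(u - w.re) + (z - w.re)‖ ≤ 2 * (r + 2 * |w.im|) := by
    refine (norm_add_le _ _).trans ?_
    have a1 := (norm_sub_re_le hr.le hu'.le).1
    have a2 := (norm_sub_re_le ht0 hz.le).1
    linarith [abs_nonneg w.im]
  rw [h1, norm_mul] at h2
  have h4 : r * (r - t) ≤ ‖u - z‖ * (2 * (r + 2 * |w.im|)) := by
    have := mul_le_mul_of_nonneg_left h3 (norm_nonneg (u - z))
    nlinarith [mul_nonneg ht0 (sub_nonneg.2 htr.le)]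
  have h5 : 0 < r * (r - t) := mul_pos hr (sub_pos.2 htr)
  have h6 : 0 < ‖u - z‖ := by
    rcases (norm_nonneg (u - z)).lt_or_eq with h | h
    · exact h
    · rw [← h, zero_mul] at h4; linarith
  rw [norm_inv, inv_eq_one_div, div_le_div_iff₀ h6 h5]
  linarith

theorem norm_remInt_le (hN : NormOnCone A) (hJ : J ∈ sphere A) (hr : 0 < r) {S : ℝ}
    (hS0 : 0 ≤ S) (hS : ∀ u ∈ lemniscate w r, ‖g u‖ ≤ S) {t : ℝ} (ht0 : 0 ≤ t) (htr : t < r)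
    {z : ℂ} (hz : ‖deltaC w z‖ = t ^ 2) (n : ℕ) :
    ‖remInt J w r g (n + 1) z‖ ≤
      (‖mulCLM A‖ + 1) * S * (2 * (r + 2 * |w.im|) / (r * (r - t))) * arcConst / r ^ n := by
  have h0 : 0 < r - t := sub_pos.2 htr
  refine norm_cassiniIntegral_le hr (by positivity) n fun u hu v => ?_
  refine (norm_Phi_mul_le hN hJ _ _).trans ?_
  have h1 := norm_inv_sub_le hr ht0 htr hu hz
  rw [norm_mul, norm_mul, norm_inv (nodePoly w (n + 1) u)]
  calc (‖mulCLM A‖ + 1) * (‖(u - z)⁻¹‖ * ‖nodePoly w (n + 1) u‖⁻¹ * ‖v‖) * ‖g u‖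
      ≤ (‖mulCLM A‖ + 1) * (2 * (r + 2 * |w.im|) / (r * (r - t)) *
          ‖nodePoly w (n + 1) u‖⁻¹ * ‖v‖) * S := by
        gcongr; exact hS u hu
    _ = _ := by rw [div_eq_inv_mul ‖v‖]; ring

theorem norm_nodePoly_succ_le {t : ℝ} (ht0 : 0 ≤ t) (htr : t ≤ r) {z : ℂ}
    (hz : ‖deltaC w z‖ = t ^ 2) (n : ℕ) :
    ‖nodePoly w (n + 1) z‖ ≤ t ^ n * (r + 2 * |w.im|) := by
  have h0 := abs_nonneg w.im
  rcases Nat.even_or_odd n with hn | hn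
  · rw [norm_nodePoly_odd hz hn]
    gcongr
    have a1 := (norm_sub_re_le ht0 hz.le).1
    have a2 := (norm_sub_re_conj w z).2
    linarith
  · rw [norm_nodePoly_even hz hn.add_one, pow_succ]
    gcongr
    linarith

theorem norm_remainder_le (halt : IsAlternative A) (hN : NormOnCone A) (hJ : J ∈ sphere A)
    (hr : 0 < r) {S : ℝ}
    (hS0 : 0 ≤ S) (hS : ∀ u ∈ lemniscate w r, ‖g u‖ ≤ S) {t : ℝ} (ht0 : 0 ≤ t) (htr : t < r)
    {z : ℂ} (hz : ‖deltaC w z‖ = t ^ 2) (n : ℕ) :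
    ‖Phi J (nodePoly w (n + 1) z) *
        (Phi J (2 * Real.pi * Complex.I)⁻¹ * remInt J w r g (n + 1) z)‖ ≤
      (‖mulCLM A‖ + 1) ^ 2 * arcConst * S * (t ^ n / r ^ n) *
        ((3 * r + 2 * |w.im|) * (r + 2 * |w.im|) ^ 2 / (r * (r - t) ^ 2)) := by
  have h0 : 0 < r - t := sub_pos.2 htr
  have hη := abs_nonneg w.im
  have hc := arcConst_pos
  set K := ‖mulCLM A‖ + 1
  have hK : 0 < K := by positivity
  set M := r + 2 * |w.im|
  have hM : 0 < M := by positivity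
  rw [← Phi_act halt hJ]
  refine (norm_Phi_mul_le hN hJ _ _).trans ?_
  have h1 := norm_remInt_le hN hJ hr hS0 hS ht0 htr hz n
  have h2 := norm_nodePoly_succ_le ht0 htr.le hz n
  have h3 : ‖(2 * (Real.pi : ℂ) * Complex.I)⁻¹‖ ≤ 1 / 2 := by
    rw [norm_inv, norm_mul, norm_mul, Complex.norm_I, Complex.norm_real, Real.norm_of_nonneg
      Real.pi_pos.le, mul_one, Complex.norm_ofNat, one_div]
    gcongr
    linarith [Real.pi_gt_three]
  rw [norm_mul]
  calc K * (‖nodePoly w (n + 1) z‖ * ‖(2 * (Real.pi : ℂ) * Complex.I)⁻¹‖) *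
        ‖remInt J w r g (n + 1) z‖
      ≤ K * (t ^ n * M * (1 / 2)) * (K * S * (2 * M / (r * (r - t))) * arcConst / r ^ n) := by
        gcongr
    _ = K ^ 2 * arcConst * S * (t ^ n / r ^ n) * (M ^ 2 / (r * (r - t))) := by
        field_simp
    _ ≤ _ := by
        -- The estimate so far is sharper than the stated one; the extra factor (3r + 2|η|)/(r - t)
        -- is at least 1.
        refine mul_le_mul_of_nonneg_left ?_ (by positivity)
        rw [div_le_div_iff₀ (by positivity) (by positivity)]
        have : r - t ≤ 3 * r + 2 * |w.im| := by linarith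
        calc M ^ 2 * (r * (r - t) ^ 2) = (M ^ 2 * (r * (r - t))) * (r - t) := by ring
          _ ≤ (M ^ 2 * (r * (r - t))) * (3 * r + 2 * |w.im|) := by gcongr
          _ = _ := by ring

/-- The modulus is t^n for even n and t^(n-1)|z - w| for odd n; the minimum covers both parities, so
the growth in n is exactly geometric. -/
theorem le_norm_nodePoly {t : ℝ} (ht : 0 < t) {z : ℂ} (hz : ‖deltaC w z‖ = t ^ 2) (n : ℕ) :
    t ^ n * min 1 (‖z - w‖ / t) ≤ ‖nodePoly w n z‖ := by
  rcases Nat.even_or_odd' n with ⟨m, rfl | rfl⟩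
  · rw [norm_nodePoly_even hz (even_two_mul m)]
    exact mul_le_of_le_one_right (by positivity) (min_le_left _ _)
  · rw [norm_nodePoly_odd hz (even_two_mul m), pow_succ, mul_assoc]
    gcongr
    calc t * min 1 (‖z - w‖ / t) ≤ t * (‖z - w‖ / t) := by gcongr; exact min_le_right _ _
      _ = ‖z - w‖ := by field_simp

theorem norm_nodePoly_le {t M : ℝ} (ht : 0 < t) {z : ℂ} (hz : ‖deltaC w z‖ ≤ t ^ 2)
    (hM : ‖z - w‖ ≤ M) (n : ℕ) : ‖nodePoly w n z‖ ≤ t ^ n * (1 + M / t) := by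
  have hM0 : 0 ≤ M := (norm_nonneg _).trans hM
  have hs : ‖deltaC w z‖ = Real.sqrt ‖deltaC w z‖ ^ 2 := (Real.sq_sqrt (norm_nonneg _)).symm
  have hst : Real.sqrt ‖deltaC w z‖ ≤ t := Real.sqrt_le_iff.2 ⟨ht.le, hz⟩
  have hs0 := Real.sqrt_nonneg ‖deltaC w z‖
  rcases Nat.even_or_odd' n with ⟨m, rfl | rfl⟩
  · rw [norm_nodePoly_even hs (even_two_mul m)]
    calc Real.sqrt ‖deltaC w z‖ ^ (2 * m) ≤ t ^ (2 * m) * 1 := by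
          rw [mul_one]; gcongr
      _ ≤ _ := by
          gcongr
          have : 0 ≤ M / t := by positivity
          linarith
  · rw [norm_nodePoly_odd hs (even_two_mul m), pow_succ, mul_assoc]
    gcongr
    refine hM.trans (le_of_eq_of_le (b := t * (M / t)) (by field_simp) ?_)
    gcongr
    linarith

end Estimates

/-! ### Uniqueness of the coefficients -/

section Uniqueness

variable {A : Type*} [NormedNonAssocRing A] [NormedSpace ℝ A] [Nontrivial A]
    [IsScalarTower ℝ A A] [SMulCommClass ℝ A A] [FiniteDimensional ℝ A]
    [StarRing A] [StarModule ℝ A]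

/-- Convergence at a single point off the nodes bounds the coefficients geometrically, so near w the
terms with k ≥ 1 sum to O(|z - w|); letting z tend to w leaves the first coefficient. Convergence at
the nodes is not required, which permits the later division by z - w. -/
theorem coeff_zero_eq_zero (halt : IsAlternative A) (hN : NormOnCone A) {J : A}
    (hJ : J ∈ sphere A) {w : ℂ} {r : ℝ} (hr : 0 < r) {e : ℕ → A}
    (h : ∀ z, ‖deltaC w z‖ < r ^ 2 → z ≠ w → z ≠ conj w →
      Tendsto (fun N => ∑ k ∈ Finset.range N, Phi J (nodePoly w k z) * e k) atTop (𝓝 0)) :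
    e 0 = 0 := by
  have hww : deltaC w w = 0 := by simp [deltaC]
  have hsmall : ∀ c : ℝ, 0 < c → ∀ᶠ z in 𝓝[≠] w, ‖deltaC w z‖ < c := by
    intro c hc
    have h1 : Tendsto (fun z => ‖deltaC w z‖) (𝓝[≠] w) (𝓝 ‖deltaC w w‖) :=
      ((continuous_deltaC w).norm.tendsto w).mono_left nhdsWithin_le_nhds
    rw [hww, norm_zero] at h1
    exact h1.eventually (gt_mem_nhds hc)
  have hne : ∀ᶠ z in 𝓝[≠] w, z ≠ w := eventually_mem_nhdsWithin
  have hne' : ∀ᶠ z in 𝓝[≠] w, z ≠ conj w := by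
    by_cases hw : conj w = w
    · rw [hw]; exact hne
    · exact nhdsWithin_le_nhds (isOpen_ne.mem_nhds (Ne.symm hw))
  obtain ⟨z₁, h1, h2, h3⟩ := ((hsmall _ (pow_pos hr 2)).and (hne.and hne')).exists
  have hΔ : deltaC w z₁ ≠ 0 := mul_ne_zero (sub_ne_zero.2 h2) (sub_ne_zero.2 h3)
  set ρ : ℝ := Real.sqrt ‖deltaC w z₁‖ with hρ
  have hρ0 : 0 < ρ := Real.sqrt_pos.2 (norm_pos_iff.2 hΔ)
  have hρ2 : ‖deltaC w z₁‖ = ρ ^ 2 := (Real.sq_sqrt (norm_nonneg _)).symm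
  set μ : ℝ := min 1 (‖z₁ - w‖ / ρ) with hμ
  have hμ0 : 0 < μ := lt_min one_pos (div_pos (norm_pos_iff.2 (sub_ne_zero.2 h2)) hρ0)
  obtain ⟨B, hB⟩ : ∃ B : ℝ, ∀ k, ‖Phi J (nodePoly w k z₁) * e k‖ ≤ B := by
    have ht := h z₁ h1 h2 h3
    have ht2 := (ht.comp (tendsto_add_atTop_nat 1)).sub ht
    have ht3 : Tendsto (fun k => Phi J (nodePoly w k z₁) * e k) atTop (𝓝 0) := by
      simpa [Function.comp_def, Finset.sum_range_succ] using ht2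
    obtain ⟨B, hB⟩ := ht3.norm.bddAbove_range
    exact ⟨B, fun k => hB ⟨k, rfl⟩⟩
  have hB0 : 0 ≤ B := (norm_nonneg _).trans (hB 0)
  set K := ‖mulCLM A‖ + 1
  have hK : 0 < K := by positivity
  have he : ∀ k, ‖e k‖ ≤ K * B / μ / ρ ^ k := by
    intro k
    have hp := nodePoly_ne_zero hΔ k
    have h4 : e k = Phi J (nodePoly w k z₁)⁻¹ * (Phi J (nodePoly w k z₁) * e k) := by
      rw [← Phi_act halt hJ, inv_mul_cancel₀ hp, Phi_one, one_mul]
    rw [h4]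
    refine (norm_Phi_mul_le hN hJ _ _).trans ?_
    rw [norm_inv]
    calc K * ‖nodePoly w k z₁‖⁻¹ * ‖Phi J (nodePoly w k z₁) * e k‖
        ≤ K * (ρ ^ k * μ)⁻¹ * B := by
          gcongr
          · exact le_norm_nodePoly hρ0 hρ2 k
          · exact hB k
      _ = _ := by field_simp
  set M : ℝ := ‖w - conj w‖ + 1
  have hM : ∀ᶠ z in 𝓝[≠] w, ‖z - conj w‖ ≤ M := by
    have h1 : Tendsto (fun z => ‖z - conj w‖) (𝓝[≠] w) (𝓝 ‖w - conj w‖) := by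
      have : Continuous fun z : ℂ => ‖z - conj w‖ := by fun_prop
      exact (this.tendsto w).mono_left nhdsWithin_le_nhds
    exact (h1.eventually (gt_mem_nhds (lt_add_one _))).mono fun _ h => le_of_lt h
  set C : ℝ := K * (1 + M / (ρ / 2)) * (K * B / μ / ρ)
  have hC : 0 ≤ C := by positivity
  -- With √|Δ_w(z)| at most half of ρ, the tail is dominated by the geometric series of ratio 1/2,
  -- whence the factor 2.
  have key : ∀ᶠ z in 𝓝[≠] w, ‖e 0‖ ≤ C * 2 * ‖z - w‖ := by
    filter_upwards [hne, hne', hM, hsmall ((ρ / 2) ^ 2) (by positivity),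
      hsmall _ (pow_pos hr 2)] with z a1 a2 a3 a4 a5
    have ht := ((h z a5 a1 a2).comp (tendsto_add_atTop_nat 1)).norm
    rw [norm_zero] at ht
    have ht' := ht.add_const (C * 2 * ‖z - w‖)
    rw [zero_add] at ht'
    refine ge_of_tendsto' ht' fun N => ?_
    have hterm : ∀ k, ‖Phi J (nodePoly w (k + 1) z) * e (k + 1)‖ ≤
        C * ‖z - w‖ * (1 / 2) ^ k := by
      intro k
      refine (norm_Phi_mul_le hN hJ _ _).trans ?_
      rw [nodePoly_succ, norm_mul]
      have b1 := norm_nodePoly_le (w := conj w) (half_pos hρ0)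
        (by rw [deltaC_conj_left]; exact a4.le) a3 k
      calc K * (‖z - w‖ * ‖nodePoly (conj w) k z‖) * ‖e (k + 1)‖
          ≤ K * (‖z - w‖ * ((ρ / 2) ^ k * (1 + M / (ρ / 2)))) * (K * B / μ / ρ ^ (k + 1)) := by
            gcongr
            exact he (k + 1)
        _ = _ := by
            simp only [C, div_pow, one_pow, pow_succ]
            field_simp
    have hsum : ‖∑ k ∈ Finset.range N, Phi J (nodePoly w (k + 1) z) * e (k + 1)‖ ≤
        C * ‖z - w‖ * 2 := by
      refine (norm_sum_le_of_le _ fun k _ => hterm k).trans ?_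
      rw [← Finset.mul_sum]
      gcongr
      exact sum_geometric_two_le N
    simp only [Function.comp_apply, Finset.sum_range_succ', nodePoly_zero, Phi_one, one_mul]
    have := norm_le_add_norm_add'
      (∑ k ∈ Finset.range N, Phi J (nodePoly w (k + 1) z) * e (k + 1)) (e 0)
    linarith
  have hlim : Tendsto (fun z => C * 2 * ‖z - w‖) (𝓝[≠] w) (𝓝 0) := by
    have : Continuous fun z : ℂ => C * 2 * ‖z - w‖ := by fun_prop
    have h5 := (this.tendsto w).mono_left (nhdsWithin_le_nhds (s := {w}ᶜ))
    simpa using h5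
  exact norm_le_zero_iff.1 (ge_of_tendsto hlim key)

/-- Induction with w variable: once the first coefficient is 0, division by z - w yields the shifted
sequence with nodes starting at w̄. -/
theorem coeff_eq_zero (halt : IsAlternative A) (hN : NormOnCone A) {J : A} (hJ : J ∈ sphere A)
    {r : ℝ} (hr : 0 < r) (n : ℕ) : ∀ {w : ℂ} {e : ℕ → A},
    (∀ z, ‖deltaC w z‖ < r ^ 2 → z ≠ w → z ≠ conj w →
      Tendsto (fun N => ∑ k ∈ Finset.range N, Phi J (nodePoly w k z) * e k) atTop (𝓝 0)) →
    e n = 0 := by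
  induction n with
  | zero => exact fun h => coeff_zero_eq_zero halt hN hJ hr h
  | succ n ih =>
    intro w e h
    have h0 := coeff_zero_eq_zero halt hN hJ hr h
    refine ih (w := conj w) (e := fun k => e (k + 1)) fun z h1 h2 h3 => ?_
    rw [deltaC_conj_left] at h1
    rw [Complex.conj_conj] at h3
    have h4 := (h z h1 h3 h2).comp (tendsto_add_atTop_nat 1)
    have h5 := ((mulCLM A (Phi J (z - w)⁻¹)).continuous.tendsto 0).comp h4
    rw [map_zero] at h5
    refine h5.congr fun N => ?_
    simp only [Function.comp_apply, mulCLM_apply, Finset.sum_range_succ', h0, mul_zero, add_zero,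
      Finset.mul_sum, ← Phi_act halt hJ, nodePoly_succ]
    refine Finset.sum_congr rfl fun k _ => ?_
    rw [inv_mul_cancel_left₀ (sub_ne_zero.2 h3)]

end Uniqueness

end SliceReg
namespace SliceReg

/-! ### The boundary supremum and the coefficients of the expansion -/

section Expansion

open Cx

variable {A : Type*} [NormedNonAssocRing A] [NormedSpace ℝ A] [Nontrivial A]
    [IsScalarTower ℝ A A] [SMulCommClass ℝ A A] [FiniteDimensional ℝ A]
    [StarRing A] [StarModule ℝ A]

variable {J : A} {w : ℂ} {r : ℝ}

theorem frontier_subset_lemniscate (hr : 0 < r) :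
    frontier (cassiniBallC w r) ⊆ lemniscate w r := by
  intro u hu
  rw [frontier, (isOpen_cassiniBallC w r).interior_eq] at hu
  have h1 : closure (cassiniBallC w r) ⊆ {u | ‖deltaC w u‖ ≤ r ^ 2} :=
    closure_minimal (fun z hz => ((mem_cassiniBallC hr).1 hz).le)
      (isClosed_le (continuous_deltaC w).norm continuous_const)
  refine le_antisymm (h1 hu.1) (not_lt.1 fun h => hu.2 ((mem_cassiniBallC hr).2 h))

theorem norm_le_supBoundary (hN : NormOnCone A) (hJ : J ∈ sphere A) (hr : 0 < r) {f : A → A}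
    (hf : ContinuousOn (fun u => f (Phi J u)) (lemniscate w r)) {u : ℂ}
    (hu : u ∈ lemniscate w r) : ‖f (Phi J u)‖ ≤ supBoundary f J (Phi J w) r := by
  obtain ⟨B, hB⟩ := (isCompact_lemniscate w r).exists_bound_of_continuousOn hf
  rw [supBoundary, cassiniBoundary_eq hN hJ]
  refine le_csSup ⟨B, ?_⟩ ⟨_, ⟨u, lemniscate_subset_frontier hr hu, rfl⟩, rfl⟩
  rintro _ ⟨_, ⟨z, hz, rfl⟩, rfl⟩
  exact hB z (frontier_subset_lemniscate hr hz)

theorem supBoundary_nonneg (f : A → A) (J y : A) (r : ℝ) : 0 ≤ supBoundary f J y r := by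
  refine Real.sSup_nonneg ?_
  rintro _ ⟨ζ, -, rfl⟩
  exact norm_nonneg _

/-- By linearity of `rep`, the remainder on any slice comes from the remainders at z and z̄ on the
slice of `J`. -/
theorem sub_sum_sphTerm (halt : IsAlternative A) {I : A} (hI : I ∈ sphere A) (hJ : J ∈ sphere A)
    (s : ℕ → A) (n : ℕ) (z : ℂ) (a b : A) :
    rep I J (a, b) - ∑ k ∈ Finset.range n, sphTerm (Phi J w) k (s k) (Phi I z) =
      rep I J (a - ∑ k ∈ Finset.range n, Phi J (nodePoly w k z) * s k,
        b - ∑ k ∈ Finset.range n, Phi J (nodePoly w k (conj z)) * s k) := by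
  simp only [sphTerm_Phi halt hI hJ]
  rw [← map_sum, ← map_sub, ← Prod.mk_sub_mk]
  congr 2
  ext <;> simp [Prod.fst_sum, Prod.snd_sum]

theorem rep_self (halt : IsAlternative A) (hJ : J ∈ sphere A) (a b : A) :
    rep J J (a, b) = a := by
  rw [rep_apply, sphere_act halt hJ]
  module

/-- The coefficients of the spherical expansion. -/
noncomputable def sphCoeff (J : A) (w : ℂ) (r : ℝ) (f : A → A) (n : ℕ) : A :=
  Phi J (2 * Real.pi * Complex.I)⁻¹ * coeffInt J w r (fun u => f (Phi J u)) n

theorem sphCoeff_eq (hN : NormOnCone A) (hJ : J ∈ sphere A) (f : A → A) (n : ℕ) :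
    sphCoeff J w r f n =
      coneInv ((2 * Real.pi) • J) * cassiniIntegral w r (coeffForm J (Phi J w) f n) := by
  have h : (2 * Real.pi) • J = Phi J (2 * Real.pi * Complex.I) := by
    rw [← Complex.ofReal_ofNat, ← Complex.ofReal_mul, Phi_real_smul, Phi_I]
  rw [h, coneInv_Phi hN hJ, sphCoeff, coeffInt]
  congr 2
  funext u v
  rw [coeffForm, actForm, sphPoly_Phi_eq hJ, coneInv_Phi hN hJ, Phi_mul hJ]

theorem norm_two_pi_I_inv_le : ‖(2 * (Real.pi : ℂ) * Complex.I)⁻¹‖ ≤ 1 := by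
  rw [norm_inv, norm_mul, norm_mul, Complex.norm_I, Complex.norm_real, Real.norm_of_nonneg
    Real.pi_pos.le, mul_one, Complex.norm_ofNat]
  exact inv_le_one_of_one_le₀ (by linarith [Real.pi_gt_three])

theorem norm_sphCoeff_le (hN : NormOnCone A) (hJ : J ∈ sphere A) (hr : 0 < r) {f : A → A}
    (hf : ContinuousOn (fun u => f (Phi J u)) (lemniscate w r)) (n : ℕ) :
    ‖sphCoeff J w r f n‖ ≤
      (‖mulCLM A‖ + 1) ^ 2 * arcConst * supBoundary f J (Phi J w) r / r ^ n := by
  have h1 := norm_coeffInt_le hN hJ hr (supBoundary_nonneg f J (Phi J w) r)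
    (fun u hu => norm_le_supBoundary hN hJ hr hf hu) n
  refine (norm_Phi_mul_le hN hJ _ _).trans ?_
  have h2 := norm_two_pi_I_inv_le
  have h3 := (norm_nonneg _).trans h1
  calc _ ≤ (‖mulCLM A‖ + 1) * 1 * ((‖mulCLM A‖ + 1) * supBoundary f J (Phi J w) r *
        arcConst / r ^ n) := by gcongr
    _ = _ := by ring

end Expansion

end SliceReg

/-! ### Assembly of the theorem -/

theorem mainTheorem3 {A : Type*} [NormedNonAssocRing A] [NormedSpace ℝ A] [Nontrivial A]
    [IsScalarTower ℝ A A] [SMulCommClass ℝ A A] [FiniteDimensional ℝ A]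
    [StarRing A] [StarModule ℝ A]
    (halt : SliceReg.IsAlternative A) (hN : SliceReg.NormOnCone A) :
    ∃ C : ℝ, 0 < C ∧ ∃ C' : ℝ, 0 < C' ∧
      ∀ (D : Set ℂ), IsOpen D → (∀ z ∈ D, conj z ∈ D) →
      ∀ (f : A → A), SliceReg.IsSliceRegular D f →
      ∀ (y J : A) (w : ℂ) (r : ℝ), y ∈ SliceReg.circularSet D → J ∈ SliceReg.sphere A →
        y = SliceReg.Phi J w → 0 < r →
        closure (SliceReg.cassiniBall y r) ∩ SliceReg.quadraticCone A ⊆ SliceReg.circularSet D →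
        (∃! s : ℕ → A, SliceReg.IsSphericalExpansion f y r s) ∧
        ∀ s : ℕ → A, SliceReg.IsSphericalExpansion f y r s →
          (∀ n, s n = SliceReg.coneInv ((2 * Real.pi) • J) *
            SliceReg.cassiniIntegral w r (SliceReg.coeffForm J y f n)) ∧
          (∀ n, ‖s n‖ ≤ C * SliceReg.supBoundary f J y r / r ^ n) ∧
          (∀ n,
            SliceReg.IsStem (SliceReg.cassiniBallC w r) (SliceReg.remStem J y w r f n) ∧
            SliceReg.IsHolo (SliceReg.cassiniBallC w r) (SliceReg.remStem J y w r f n) ∧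
            (∀ x ∈ SliceReg.cassiniBall y r,
              f x - ∑ k ∈ Finset.range (n + 1), SliceReg.sphTerm y k (s k) x =
                (2 * Real.pi)⁻¹ •
                  SliceReg.sliceMul (SliceReg.sphStem y (n + 1))
                    (SliceReg.remStem J y w r f n) x) ∧
            ((∀ a b c : A, a * b * c = a * (b * c)) →
              ∀ x ∈ SliceReg.cassiniBall y r,
                SliceReg.slice (SliceReg.remStem J y w r f n) x =
                  SliceReg.cassiniIntegral w r (SliceReg.remFormAssoc J y f n x))) ∧
          (∀ n, ∀ x ∈ SliceReg.cassiniBall y r,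
            ‖f x - ∑ k ∈ Finset.range (n + 1), SliceReg.sphTerm y k (s k) x‖ ≤
              C' * SliceReg.supBoundary f J y r *
                (SliceReg.cassini x y ^ n / r ^ n) *
                ((3 * r + 2 * |w.im|) * (r + 2 * |w.im|) ^ 2 /
                  (r * (r - SliceReg.cassini x y) ^ 2))) := by
  open SliceReg in
  have hK : 0 < ‖mulCLM A‖ + 1 := by positivity
  have hc := arcConst_pos
  -- One factor of the multiplication constant comes from the integrand and one from the left
  -- multiplication outside the integral; the second constant carries in addition the bound of
  -- `rep`.
  refine ⟨(‖mulCLM A‖ + 1) ^ 2 * arcConst, by positivity,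
    (1 + (‖mulCLM A‖ + 1) ^ 2) * ((‖mulCLM A‖ + 1) ^ 2 * arcConst), by positivity, ?_⟩
  rintro D hD hDc f ⟨F, hFs, hFh, hfF⟩ y J w r - hJ rfl hr hcl
  have hsub := closedBall_subset hN hDc hJ hr hcl
  have hmem : ∀ u, ‖deltaC w u‖ ≤ r ^ 2 → u ∈ D := fun u hu => hsub hu
  have hfI : ∀ I ∈ sphere A, ∀ u ∈ D, f (Phi I u) = Cx.ev I (F u) := fun I hI u hu => by
    rw [hfF _ ⟨Phi_mem_quadraticCone hI u, u, hu, I, hI, rfl⟩, slice_Phi hFs hu hI]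
  have hg : IsLeftHolo J D fun u => f (Phi J u) :=
    (hFh.isLeftHolo halt hJ hD).congr fun u hu => hfI J hJ u hu
  have hgc : ContinuousOn (fun u => f (Phi J u)) (lemniscate w r) :=
    (hg.contDiffOn hD).continuousOn.mono fun u hu => hmem u (le_of_eq hu)
  have hrep : ∀ I ∈ sphere A, ∀ z, ‖deltaC w z‖ < r ^ 2 →
      f (Phi I z) = rep I J (f (Phi J z), f (Phi J (conj z))) := fun I hI z hz => by
    have hzD := hmem z hz.le
    rw [hfI I hI z hzD, ev_eq_rep halt I hJ, hfI J hJ z hzD, hfI J hJ _ (hDc z hzD), hFs z hzD]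
  have hball : ∀ x ∈ cassiniBall (Phi J w) r, ∃ I ∈ sphere A, ∃ z : ℂ, x = Phi I z ∧
      ‖deltaC w z‖ < r ^ 2 := fun x hx => by
    obtain ⟨I, hI, z, rfl⟩ := exists_eq_Phi hJ hx.1
    exact ⟨I, hI, z, rfl, (mem_cassiniBallC hr).1 ((Phi_mem_cassiniBall hN hI hJ w z r).1 hx)⟩
  have hrem : ∀ I ∈ sphere A, ∀ z, ‖deltaC w z‖ < r ^ 2 → ∀ n,
      f (Phi I z) - ∑ k ∈ Finset.range n, sphTerm (Phi J w) k (sphCoeff J w r f k) (Phi I z) =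
        rep I J (Phi J (nodePoly w n z) * (Phi J (2 * Real.pi * Complex.I)⁻¹ *
            remInt J w r (fun u => f (Phi J u)) n z),
          Phi J (nodePoly w n (conj z)) * (Phi J (2 * Real.pi * Complex.I)⁻¹ *
            remInt J w r (fun u => f (Phi J u)) n (conj z))) := fun I hI z hz n => by
    have hz' : ‖deltaC w (conj z)‖ < r ^ 2 := by rwa [deltaC_conj, RCLike.norm_conj]
    rw [hrep I hI z hz, sub_sum_sphTerm halt hI hJ,
      ← sub_sum_eq_remInt halt hJ hr hD hsub hg hz, ← sub_sum_eq_remInt halt hJ hr hD hsub hg hz']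
    rfl
  have hbound : ∀ n, ∀ x ∈ cassiniBall (Phi J w) r,
      ‖f x - ∑ k ∈ Finset.range (n + 1), sphTerm (Phi J w) k (sphCoeff J w r f k) x‖ ≤
        (1 + (‖mulCLM A‖ + 1) ^ 2) * ((‖mulCLM A‖ + 1) ^ 2 * arcConst) *
          supBoundary f J (Phi J w) r * (cassini x (Phi J w) ^ n / r ^ n) *
          ((3 * r + 2 * |w.im|) * (r + 2 * |w.im|) ^ 2 /
            (r * (r - cassini x (Phi J w)) ^ 2)) := by
    intro n x hx
    have hτr : cassini x (Phi J w) < r := hx.2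
    obtain ⟨I, hI, z, rfl, hz⟩ := hball x hx
    rw [hrem I hI z hz]
    rw [cassini_Phi hN hI hJ] at hτr ⊢
    have hS := fun u hu => norm_le_supBoundary hN hJ hr hgc (u := u) hu
    have hS0 := supBoundary_nonneg f J (Phi J w) r
    have hτ : ‖deltaC w z‖ = Real.sqrt ‖deltaC w z‖ ^ 2 := (Real.sq_sqrt (norm_nonneg _)).symm
    have hτ' : ‖deltaC w (conj z)‖ = Real.sqrt ‖deltaC w z‖ ^ 2 := by
      rw [deltaC_conj, RCLike.norm_conj]; exact hτ
    refine (norm_rep_le hN hI hJ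
      (norm_remainder_le halt hN hJ hr hS0 hS (Real.sqrt_nonneg _) hτr hτ n)
      (norm_remainder_le halt hN hJ hr hS0 hS (Real.sqrt_nonneg _) hτr hτ' n)).trans
      (le_of_eq ?_)
    ring
  have hexp : IsSphericalExpansion f (Phi J w) r (sphCoeff J w r f) := by
    intro x hx
    -- The remainder bound of order n concerns the partial sum with n + 1 terms, hence the shift.
    rw [← tendsto_add_atTop_iff_nat 1, tendsto_iff_norm_sub_tendsto_zero]
    refine squeeze_zero (fun _ => norm_nonneg _) (fun n => ?_) (g := fun n =>
      (1 + (‖mulCLM A‖ + 1) ^ 2) * ((‖mulCLM A‖ + 1) ^ 2 * arcConst) *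
          supBoundary f J (Phi J w) r * (cassini x (Phi J w) / r) ^ n *
          ((3 * r + 2 * |w.im|) * (r + 2 * |w.im|) ^ 2 /
            (r * (r - cassini x (Phi J w)) ^ 2))) ?_
    · rw [norm_sub_rev, div_pow]
      exact hbound n x hx
    · have h1 : Tendsto (fun n => (cassini x (Phi J w) / r) ^ n) atTop (𝓝 0) :=
        tendsto_pow_atTop_nhds_zero_of_lt_one (div_nonneg (Real.sqrt_nonneg _) hr.le)
          ((div_lt_one hr).2 hx.2)
      simpa using (h1.const_mul _).mul_const _
  have huniq : ∀ s : ℕ → A, IsSphericalExpansion f (Phi J w) r s → s = sphCoeff J w r f := by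
    intro s hs
    funext n
    rw [← sub_eq_zero]
    refine coeff_eq_zero halt hN hJ hr n (w := w) (e := fun n => s n - sphCoeff J w r f n)
      fun z hz _ _ => ?_
    -- Restriction to the slice of `J`, where `rep J J` is the first projection, reduces uniqueness
    -- to scalar node polynomials.
    have hx := (Phi_mem_cassiniBall hN hJ hJ w z r).2 ((mem_cassiniBallC hr).2 hz)
    have h1 := (hs _ hx).sub (hexp _ hx)
    simpa only [sub_self, sphTerm_Phi halt hJ hJ, rep_self halt hJ, ← Finset.sum_sub_distrib,
      ← mul_sub] using h1
  refine ⟨⟨_, hexp, huniq⟩, fun s hs => ?_⟩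
  obtain rfl := huniq s hs
  refine ⟨fun n => sphCoeff_eq hN hJ f n, norm_sphCoeff_le hN hJ hr hgc, fun n => ⟨
    isStem_remStem _ _ f n, isHolo_remStem halt hN hJ hr hgc n, fun x hx => ?_,
    fun hassoc x hx => ?_⟩, hbound⟩
  · obtain ⟨I, hI, z, rfl, hz⟩ := hball x hx
    have hz' : ‖deltaC w (conj z)‖ < r ^ 2 := by rwa [deltaC_conj, RCLike.norm_conj]
    have hst := (isStem_sphStem hJ univ w (n + 1)).mul
      (isStem_remStem univ (Phi J w) (w := w) (r := r) (J := J) f n)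
    -- The real factor gives the (2π)⁻¹ in front; the factor i⁻¹ is the J⁻¹ inside the remainder
    -- integral.
    have hI' : (2 * Real.pi * Complex.I : ℂ)⁻¹ = ((2 * Real.pi)⁻¹ : ℝ) * Complex.I⁻¹ := by
      push_cast; rw [mul_inv]
    rw [hrem I hI z hz, sliceMul, slice_Phi hst (mem_univ z) hI, ev_eq_rep halt I hJ,
      ← hst z (mem_univ z), ev_sphStem_mul halt hJ, ev_sphStem_mul halt hJ,
      ev_remStem halt hN hJ hr hgc n hz, ev_remStem halt hN hJ hr hgc n hz', ← map_smul, hI',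
      Phi_real_smul]
    simp only [Prod.smul_mk, smul_mul_assoc, mul_smul_comm]
  · obtain ⟨I, hI, z, rfl, hz⟩ := hball x hx
    exact slice_remStem_of_assoc hN hJ hr hgc n hassoc hI hz
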